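/- Let $q$ be a prime power, let $n\ge 0$ and $t\ge 1$ be integers, and regard $\mathbb F_q$ as a subfield of $\mathbb F_{q^t}$. Dimensions of subspaces are projective. A point-line geometry consists of points, lines and an incidence relation; an isomorphism is a pair of bijections (on points and on lines) preserving incidence in both directions, and $\mathrm{Aut}$ denotes the full automorphism group. Let $\pi$ be an $n$-dimensional subspace of $\mathrm{PG}(n+t,q)$. Let $X(n,t,q)$ be the geometry whose points are the $(t-1)$-dimensional subspaces of $\mathrm{PG}(n+t,q)$ skew to $\pi$ and whose lines are the $t$-dimensional subspaces meeting $\pi$ in exactly one point, with incidence given by containment. Let $H_\infty\cong\mathrm{PG}(n,q^t)$ be a hyperplane of $\mathrm{PG}(n+1,q^t)$, and let $\mathcal S\cong \mathrm{PG}(n,q)$ be an $n$-dimensional subgeometry of $H_\infty$ of order $q$, i.e. the set of all points of $H_\infty$ that have homogeneous coordinates in $\mathbb F_q$ with respect to some fixed frame of $H_\infty$. Let $T_n^*(\mathcal S)$ be the geometry whose points are the points of $\mathrm{PG}(n+1,q^t)$ not in $H_\infty$ and whose lines are the lines of $\mathrm{PG}(n+1,q^t)$ that meet $H_\infty$ exactly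 in a point of $\mathcal S$, with natural incidence. Let $\mathcal M$ be the coset geometry whose points are the $(n+1)\times t$ matrices over $\mathbb F_q$ and whose lines are the cosets, in the additive group of these matrices, of the subgroups $L_b=\{b^{T}a : a\in\mathbb F_q^t\}$ for nonzero row vectors $b\in\mathbb F_q^{n+1}$, with incidence given by membership. Then $$X(n,t,q)\;\cong\;\mathcal M\;\cong\;T_n^*(\mathcal S),\qquad\text{and hence}\qquad \mathrm{Aut}(T_n^*(\mathcal S))\cong\mathrm{Aut}(X(n,t,q)).$$ If moreover $n\ge 1$ and $(t,q)\ne(1,2)$, then $$\mathrm{Aut}(T_n^*(\mathcal S))\;\cong\;\mathrm{Aut}(X(n,t,q))\;\cong\;\mathrm{P\Gamma L}(n+t+1,q)_\pi ,$$ where $\mathrm{P\Gamma L}(n+t+1,q)_\pi$ is the group of those permutations of the points of $\mathrm{PG}(n+t,q)$ that are induced by bijective semilinear maps of $\mathbb F_q^{n+t+1}$ and that map $\pi$ onto itself. -/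

import Mathlib

open scoped LinearAlgebra.Projectivization Pointwise

universe u v

/-- A point-line incidence structure. -/
structure PointLineGeometry where
  Point : Type u
  Line : Type u
  Inc : Point → Line → Prop

namespace PointLineGeometry

/-- An isomorphism of incidence structures: bijections on points and on lines that preserve
incidence and non-incidence. -/
structure Iso (G : PointLineGeometry.{u}) (G' : PointLineGeometry.{v}) where
  onPoints : G.Point ≃ G'.Point
  onLines : G.Line ≃ G'.Line
  inc_iff : ∀ p l, G'.Inc (onPoints p) (onLines l) ↔ G.Inc p l

/-- The full automorphism group of an incidence structure, under composition. -/
def Aut (G : PointLineGeometry.{u}) : Subgroup (Equiv.Perm G.Point × Equiv.Perm G.Line) where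
  carrier := {g | ∀ p l, G.Inc (g.1 p) (g.2 l) ↔ G.Inc p l}
  mul_mem' := fun {a b} ha hb p l => (ha (b.1 p) (b.2 l)).trans (hb p l)
  one_mem' := fun _ _ => Iff.rfl
  inv_mem' := fun {a} ha p l => by
    have h := ha (a.1⁻¹ p) (a.2⁻¹ l)
    simpa using h.symm

end PointLineGeometry

/-- The geometry `X(n,t,q)` of a subspace `π` of the projective space of `V`. Projective
`k`-spaces are vector subspaces of dimension `k + 1`: points are the `(t-1)`-spaces skew to `π`,
lines are the `t`-spaces meeting `π` in exactly one (projective) point. -/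
def geometryX {F : Type*} {V : Type u} [Field F] [AddCommGroup V] [Module F V]
    (t : ℕ) (π : Submodule F V) : PointLineGeometry.{u} where
  Point := {U : Submodule F V // Module.finrank F U = t ∧ U ⊓ π = ⊥}
  Line := {L : Submodule F V // Module.finrank F L = t + 1 ∧
    Module.finrank F (L ⊓ π : Submodule F V) = 1}
  Inc := fun U L => U.1 ≤ L.1

/-- The linear representation `T*(S)` of a point set `S` at infinity, in the projective space of
`W` with hyperplane at infinity `H`: points are the projective points off `H`, lines are the
projective lines meeting `H` exactly in a point of `S`. -/
def linearRepresentation {K : Type*} {W : Type u} [Field K] [AddCommGroup W] [Module K W]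
    (H : Submodule K W) (S : Set (ℙ K W)) : PointLineGeometry.{u} where
  Point := {P : ℙ K W // ¬ P.submodule ≤ H}
  Line := {L : Submodule K W // Module.finrank K L = 2 ∧ ∃ P ∈ S, L ⊓ H = P.submodule}
  Inc := fun P L => P.1.submodule ≤ L.1

/-- `S` is an `n`-dimensional subgeometry over `F` of the `n`-dimensional projective space of
`H`: for a suitable basis of `H`, it is the set of the projective points that have homogeneous
coordinates in the subfield `F` of `K`. -/
def IsSubgeometry (F : Type*) {K W : Type*} [Field F] [Field K] [Algebra F K]
    [AddCommGroup W] [Module K W] (n : ℕ) (H : Submodule K W) (S : Set (ℙ K W)) : Prop :=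
  ∃ b : Module.Basis (Fin (n + 1)) K H,
    S = {P | ∃ a : Fin (n + 1) → F, a ≠ 0 ∧
      P.submodule = Submodule.span K {∑ i, algebraMap F K (a i) • (b i : W)}}

/-- The subgroup `{bᵀ a | a ∈ F^t}` of the additive group of `(n+1) × t` matrices. -/
def matrixSubgroup {F : Type*} [Field F] {n : ℕ} (t : ℕ) (b : Fin (n + 1) → F) :
    AddSubgroup (Matrix (Fin (n + 1)) (Fin t) F) where
  carrier := Set.range fun a : Fin t → F => Matrix.vecMulVec b a
  add_mem' := by
    rintro _ _ ⟨a, rfl⟩ ⟨c, rfl⟩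
    exact ⟨a + c, Matrix.vecMulVec_add b a c⟩
  zero_mem' := ⟨0, by ext; simp [Matrix.vecMulVec_apply]⟩
  neg_mem' := by
    rintro _ ⟨a, rfl⟩
    exact ⟨-a, Matrix.vecMulVec_neg b a⟩

/-- The coset geometry: points are the `(n+1) × t` matrices over `F`, lines are the cosets of the
subgroups `{bᵀ a | a ∈ F^t}` with `b ≠ 0`. -/
def matrixGeometry (F : Type u) [Field F] (n t : ℕ) : PointLineGeometry.{u} where
  Point := Matrix (Fin (n + 1)) (Fin t) F
  Line := {C : Set (Matrix (Fin (n + 1)) (Fin t) F) //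
    ∃ b : Fin (n + 1) → F, b ≠ 0 ∧ ∃ A : Matrix (Fin (n + 1)) (Fin t) F,
      C = A +ᵥ (matrixSubgroup t b : Set (Matrix (Fin (n + 1)) (Fin t) F))}
  Inc := fun A C => A ∈ C.1

/-- The group `PΓL(V)`: the permutations of the points of the projective space of `V` that are
induced by a bijective semilinear map of `V`. -/
def PGammaL (F V : Type*) [Field F] [AddCommGroup V] [Module F V] :
    Subgroup (Equiv.Perm (ℙ F V)) where
  carrier := {g | ∃ (σ τ : F →+* F) (_ : RingHomInvPair σ τ) (_ : RingHomInvPair τ σ)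
    (f : V ≃ₛₗ[σ] V), ∀ P, g P = Projectivization.map f.toLinearMap f.injective P}
  one_mem' := ⟨RingHom.id F, RingHom.id F, inferInstance, inferInstance, LinearEquiv.refl F V,
    fun P => by
      induction P using Projectivization.ind with
      | h v hv => rfl⟩
  mul_mem' := by
    rintro g g' ⟨σ, τ, h1, h2, f, hf⟩ ⟨σ', τ', h1', h2', f', hf'⟩
    have : RingHomCompTriple σ' σ (σ.comp σ') := ⟨rfl⟩
    have : RingHomCompTriple τ τ' (τ'.comp τ) := ⟨rfl⟩
    have i1 : RingHomInvPair (σ.comp σ') (τ'.comp τ) :=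
      ⟨RingHom.ext fun x => (congrArg τ' (h1.comp_apply_eq)).trans h1'.comp_apply_eq,
        RingHom.ext fun x => (congrArg σ (h1'.comp_apply_eq₂)).trans h1.comp_apply_eq₂⟩
    have i2 : RingHomInvPair (τ'.comp τ) (σ.comp σ') :=
      ⟨i1.comp_eq₂, i1.comp_eq⟩
    refine ⟨σ.comp σ', τ'.comp τ, i1, i2, f'.trans f, fun P => ?_⟩
    rw [Equiv.Perm.mul_apply, hf', hf]
    induction P using Projectivization.ind with
    | h v hv => rfl
  inv_mem' := by
    rintro g ⟨σ, τ, h1, h2, f, hf⟩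
    refine ⟨τ, σ, h2, h1, f.symm, fun P => ?_⟩
    rw [Equiv.Perm.inv_eq_iff_eq, hf]
    induction P using Projectivization.ind with
    | h v hv => simp [Projectivization.map_mk]

/-- The stabiliser `PΓL(V)_π` of a subspace `π`: the elements of `PΓL(V)` that map the set of
projective points of `π` onto itself. -/
def PGammaLStabilizer {F V : Type*} [Field F] [AddCommGroup V] [Module F V]
    (π : Submodule F V) : Subgroup (PGammaL F V) :=
  MulAction.stabilizer (PGammaL F V) {P : ℙ F V | P.submodule ≤ π}

-- Choose coordinates `V ≃ F^(n+1) × F^t` in which `π` is the first factor. A complement of `π` is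
-- then the graph `{(Aa, a)}` of a unique matrix `A`, and a `(t+1)`-dimensional vector subspace
-- meeting `π` in `⟨b⟩` is a pencil `{(Aa + kb, a)}`. The graph of `M` lies in that pencil exactly
-- when `M - A` is a rank one matrix `bᵀa` or zero, so `X(n,t,q)` is the coset geometry of matrices.
-- The same computation over `K` with `t = 1` describes `T*(S)` by columns over `K`; an `F`-linear
-- identification of `F^t` with `K` turns rows into entries, and the directions `b` remain those
-- over `F`. Since lines are determined by their points, it is enough in both cases to match point
-- sets of lines (`Iso.ofPoints`).
--
-- For the automorphism group, let `φ` be a permutation of matrices that maps lines to lines. If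
-- `q^t ≥ 3` and `n ≥ 1`, then `φ` respects parallelism (`parallel_step`,
-- `PreservesLines.exists_direction`): two parallel lines joined by a third have a transversal, and
-- this forces their images to be parallel. Completing parallelograms makes `φ` additive up to a
-- translation (`map_add_of_direction`). On rank one matrices the linear part acts separately on
-- column and row, and additivity in the column makes the row action semilinear, so `φ` is `M ↦ G
-- M^σ H + N` (`PreservesLines.exists_semilinear`).
--
-- Each such map is induced by a semilinear map of `V` stabilising `π` (`exists_semilinearEquiv`),
-- which gives surjectivity of `stabilizerToAut`. Injectivity holds because the complements through
-- a point off `π` meet only in that point, and a collineation fixing all points off `π` and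
-- preserving `π` fixes the points of `π` too.

universe w

/-! ### Isomorphisms and automorphism groups of incidence geometries. -/

namespace PointLineGeometry

/-- The inverse isomorphism. -/
def Iso.symm {G : PointLineGeometry.{u}} {G' : PointLineGeometry.{v}} (φ : G.Iso G') :
    G'.Iso G where
  onPoints := φ.onPoints.symm
  onLines := φ.onLines.symm
  inc_iff p l := by
    have h := φ.inc_iff (φ.onPoints.symm p) (φ.onLines.symm l)
    simpa using h.symm

/-- The composition of isomorphisms. -/
def Iso.trans {G : PointLineGeometry.{u}} {G' : PointLineGeometry.{v}}
    {G'' : PointLineGeometry.{w}} (φ : G.Iso G') (ψ : G'.Iso G'') : G.Iso G'' where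
  onPoints := φ.onPoints.trans ψ.onPoints
  onLines := φ.onLines.trans ψ.onLines
  inc_iff p l := (ψ.inc_iff _ _).trans (φ.inc_iff p l)

/-- Isomorphic geometries have isomorphic automorphism groups. -/
def Iso.autCongr {G : PointLineGeometry.{u}} {G' : PointLineGeometry.{v}} (φ : G.Iso G') :
    G.Aut ≃* G'.Aut where
  toFun g := ⟨(φ.onPoints.permCongr g.1.1, φ.onLines.permCongr g.1.2), fun p l => by
    have h := φ.symm.inc_iff p l
    simp only [Equiv.permCongr_apply, φ.inc_iff]
    exact (g.2 _ _).trans h⟩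
  invFun g := ⟨(φ.onPoints.symm.permCongr g.1.1, φ.onLines.symm.permCongr g.1.2), fun p l => by
    have h := φ.inc_iff p l
    simp only [Equiv.permCongr_apply]
    exact (φ.symm.inc_iff _ _).trans ((g.2 _ _).trans h)⟩
  left_inv g := by
    apply Subtype.ext
    apply Prod.ext <;> ext x <;> simp
  right_inv g := by
    apply Subtype.ext
    apply Prod.ext <;> ext x <;> simp
  map_mul' g g' := by
    apply Subtype.ext
    apply Prod.ext <;> ext x <;> simp

/-- A geometry in which every line is determined by the set of its points. -/
def LineExt (G : PointLineGeometry.{u}) : Prop :=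
  ∀ l l' : G.Line, (∀ p, G.Inc p l ↔ G.Inc p l') → l = l'

/-- If lines are determined by their points, a bijection on points that matches the point sets
of lines extends to an isomorphism. -/
noncomputable def Iso.ofPoints {G : PointLineGeometry.{u}} {G' : PointLineGeometry.{v}}
    (φ : G.Point ≃ G'.Point) (hG : G.LineExt) (hG' : G'.LineExt)
    (h : ∀ l, ∃ l', ∀ p, G'.Inc (φ p) l' ↔ G.Inc p l)
    (h' : ∀ l', ∃ l, ∀ p, G'.Inc (φ p) l' ↔ G.Inc p l) : G.Iso G' where
  onPoints := φ
  onLines := Equiv.ofBijective (fun l => (h l).choose) <| by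
    refine ⟨fun l₁ l₂ e => hG _ _ fun p => ?_, fun l' => ?_⟩
    · rw [← (h l₁).choose_spec p, ← (h l₂).choose_spec p]
      exact iff_of_eq (congrArg _ e)
    · obtain ⟨l, hl⟩ := h' l'
      refine ⟨l, hG' _ _ fun p => ?_⟩
      obtain ⟨p, rfl⟩ := φ.surjective p
      rw [hl p, ← (h l).choose_spec p]
  inc_iff p l := (h l).choose_spec p

/-- If lines are determined by their points, so are automorphisms. -/
theorem Aut.ext_points {G : PointLineGeometry.{u}} (hG : G.LineExt) {g g' : G.Aut}
    (h : ∀ p, g.1.1 p = g'.1.1 p) : g = g' := by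
  apply Subtype.ext
  apply Prod.ext
  · exact Equiv.ext h
  · ext l
    refine hG _ _ fun p => ?_
    obtain ⟨p, rfl⟩ := g.1.1.surjective p
    rw [g.2 p l, h, g'.2 p l]

end PointLineGeometry

/-! ### Graphs and pencils: matrix coordinates for subspaces relative to `π`. -/

section Coordinates

variable {F V : Type*} [Field F] [AddCommGroup V] [Module F V] {m t : ℕ}

/-- Coordinates on a subspace extend to coordinates on the whole space. -/
theorem exists_coordinates (hV : Module.finrank F V = m + t) (π : Submodule F V)
    [FiniteDimensional F V] (c : π ≃ₗ[F] (Fin m → F)) :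
    ∃ e : V ≃ₗ[F] (Fin m → F) × (Fin t → F),
      (∀ v, v ∈ π ↔ (e v).2 = 0) ∧ ∀ v : π, e v = (c v, 0) := by
  obtain ⟨Q, hQ⟩ := π.exists_isCompl
  have h1 := Submodule.finrank_add_eq_of_isCompl hQ
  have h2 : Module.finrank F π = m := by rw [c.finrank_eq]; simp
  have h3 : Module.finrank F Q = Module.finrank F (Fin t → F) := by simp; omega
  refine ⟨(Submodule.prodEquivOfIsCompl π Q hQ).symm.trans
    (c.prodCongr (LinearEquiv.ofFinrankEq _ _ h3)), fun v => ?_, fun v => ?_⟩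
  · simp
  · simp

variable (e : V ≃ₗ[F] (Fin m → F) × (Fin t → F))

/-- The map `(x, a) ↦ x - A a` in the coordinates `e`. -/
def deviation (A : Matrix (Fin m) (Fin t) F) : V →ₗ[F] (Fin m → F) :=
  (LinearMap.fst F _ _ - A.mulVecLin ∘ₗ LinearMap.snd F _ _) ∘ₗ e.toLinearMap

/-- The graph `{(A a, a)}` of a matrix in the coordinates `e`. -/
def graphSubmodule (A : Matrix (Fin m) (Fin t) F) : Submodule F V :=
  LinearMap.ker (deviation e A)

/-- The span of the graph of `A` and the vector `(b, 0)` in the coordinates `e`. -/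
def pencilSubmodule (A : Matrix (Fin m) (Fin t) F) (b : Fin m → F) : Submodule F V :=
  (Submodule.span F {b}).comap (deviation e A)

variable {e}

theorem mem_graphSubmodule {A : Matrix (Fin m) (Fin t) F} {v : V} :
    v ∈ graphSubmodule e A ↔ (e v).1 = A.mulVec (e v).2 := by
  simp [graphSubmodule, deviation, sub_eq_zero]

theorem mem_pencilSubmodule {A : Matrix (Fin m) (Fin t) F} {b : Fin m → F} {v : V} :
    v ∈ pencilSubmodule e A b ↔ ∃ k : F, (e v).1 = A.mulVec (e v).2 + k • b := by
  simp [pencilSubmodule, deviation, Submodule.mem_span_singleton, eq_sub_iff_add_eq', eq_comm]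

theorem graphSubmodule_injective : Function.Injective (graphSubmodule e) := by
  intro A B h
  refine Matrix.mulVec_injective (funext fun a => ?_)
  have : e.symm (A.mulVec a, a) ∈ graphSubmodule e B := by
    rw [← h]; simp [mem_graphSubmodule]
  simpa [mem_graphSubmodule] using this

theorem finrank_graphSubmodule (A : Matrix (Fin m) (Fin t) F) :
    Module.finrank F (graphSubmodule e A) = t := by
  have h : graphSubmodule e A =
      LinearMap.range (e.symm.toLinearMap ∘ₗ A.mulVecLin.prod LinearMap.id) := by
    ext v
    rw [mem_graphSubmodule, LinearMap.mem_range]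
    constructor
    · intro h
      exact ⟨(e v).2, e.injective (by simp [Prod.ext_iff, h])⟩
    · rintro ⟨a, rfl⟩
      simp
  rw [h, LinearMap.finrank_range_of_inj]
  · simp
  · intro a a' haa
    simpa using congrArg (fun v => (e v).2) haa

theorem finrank_pencilSubmodule (A : Matrix (Fin m) (Fin t) F) {b : Fin m → F} (hb : b ≠ 0) :
    Module.finrank F (pencilSubmodule e A b) = t + 1 := by
  have h : pencilSubmodule e A b = LinearMap.range (e.symm.toLinearMap ∘ₗ
      (A.mulVecLin ∘ₗ LinearMap.fst F (Fin t → F) F +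
        (LinearMap.snd F (Fin t → F) F).smulRight b).prod (LinearMap.fst F _ _)) := by
    ext v
    rw [mem_pencilSubmodule, LinearMap.mem_range]
    constructor
    · rintro ⟨k, h⟩
      exact ⟨((e v).2, k), e.injective (by simp [Prod.ext_iff, h])⟩
    · rintro ⟨⟨a, k⟩, rfl⟩
      exact ⟨k, by simp⟩
  rw [h, LinearMap.finrank_range_of_inj]
  · simp
  · rintro ⟨a, k⟩ ⟨a', k'⟩ haa
    have h2 : a = a' := by simpa using congrArg (fun v => (e v).2) haa
    have h1 := congrArg (fun v => (e v).1) haa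
    subst h2
    simp only [LinearMap.coe_comp, Function.comp_apply, LinearEquiv.coe_coe,
      LinearEquiv.apply_symm_apply] at h1
    have h3 : k • b = k' • b := by simpa using h1
    rw [smul_left_injective F hb h3]

/-- The condition says that `M - A` maps every vector into `⟨b⟩`. The coefficients of its values on
the standard basis form the row `a`. -/
theorem graphSubmodule_le_pencilSubmodule {M A : Matrix (Fin m) (Fin t) F} {b : Fin m → F} :
    graphSubmodule e M ≤ pencilSubmodule e A b ↔ ∃ a, M = A + Matrix.vecMulVec b a := by
  constructor
  · intro h
    have h1 (j : Fin t) : ∃ k : F, M.mulVec (Pi.single j 1) =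
        A.mulVec (Pi.single j 1) + k • b := by
      have : e.symm (M.mulVec (Pi.single j 1), Pi.single j 1) ∈ pencilSubmodule e A b :=
        h (by simp [mem_graphSubmodule])
      simpa [mem_pencilSubmodule] using this
    choose k hk using h1
    refine ⟨k, ?_⟩
    ext i j
    have := congrFun (hk j) i
    simpa [Matrix.vecMulVec_apply, mul_comm] using this
  · rintro ⟨a, rfl⟩ v hv
    rw [mem_graphSubmodule] at hv
    rw [mem_pencilSubmodule]
    refine ⟨a ⬝ᵥ (e v).2, ?_⟩
    rw [hv, Matrix.add_mulVec, Matrix.vecMulVec_mulVec]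
    simp

/-- A pencil is spanned by the graphs it contains, so it is determined by its points. A vector off
`π` lies on one such graph, obtained by correcting `A` in a coordinate `j` where the second
component is nonzero. A vector of `π` is a difference of two vectors off `π`, which exist because `0
< t`. -/
theorem pencilSubmodule_le (ht : 0 < t) {A : Matrix (Fin m) (Fin t) F} {b : Fin m → F}
    {L : Submodule F V} (h : ∀ M, graphSubmodule e M ≤ pencilSubmodule e A b →
      graphSubmodule e M ≤ L) : pencilSubmodule e A b ≤ L := by
  have key (v) (hv : v ∈ pencilSubmodule e A b) (h0 : (e v).2 ≠ 0) : v ∈ L := by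
    obtain ⟨j, hj⟩ := Function.ne_iff.mp h0
    obtain ⟨k, hk⟩ := mem_pencilSubmodule.mp hv
    refine h (A + Matrix.vecMulVec b (Pi.single j (k / (e v).2 j)))
      (graphSubmodule_le_pencilSubmodule.mpr ⟨_, rfl⟩) (mem_graphSubmodule.mpr ?_)
    rw [hk, Matrix.add_mulVec, Matrix.vecMulVec_mulVec]
    simp only [single_dotProduct]
    rw [div_mul_cancel₀ _ hj]
    simp
  intro v hv
  by_cases h0 : (e v).2 = 0
  · set w := e.symm (A.mulVec (Pi.single ⟨0, ht⟩ 1), Pi.single ⟨0, ht⟩ 1)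
    have hw : w ∈ pencilSubmodule e A b := mem_pencilSubmodule.mpr ⟨0, by simp [w]⟩
    have := key (v + w) (add_mem hv hw) (by simp [h0, w])
    simpa using sub_mem this (key w hw (by simp [w]))
  · exact key v hv h0

variable {π : Submodule F V}

theorem graphSubmodule_inf (he : ∀ v, v ∈ π ↔ (e v).2 = 0) (A : Matrix (Fin m) (Fin t) F) :
    graphSubmodule e A ⊓ π = ⊥ := by
  rw [Submodule.eq_bot_iff]
  rintro v ⟨h1, h2⟩
  rw [SetLike.mem_coe, mem_graphSubmodule] at h1
  rw [SetLike.mem_coe, he] at h2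
  apply e.injective
  rw [h2] at h1
  ext1 <;> simp [h1, h2]

theorem pencilSubmodule_inf (he : ∀ v, v ∈ π ↔ (e v).2 = 0) (A : Matrix (Fin m) (Fin t) F)
    (b : Fin m → F) :
    pencilSubmodule e A b ⊓ π = Submodule.span F {e.symm (b, 0)} := by
  ext v
  rw [Submodule.mem_inf, mem_pencilSubmodule, he, Submodule.mem_span_singleton]
  constructor
  · rintro ⟨⟨k, hk⟩, h0⟩
    refine ⟨k, e.injective ?_⟩
    rw [h0] at hk
    ext1 <;> simp [hk, h0]
  · rintro ⟨k, rfl⟩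
    simp only [map_smul, LinearEquiv.apply_symm_apply]
    exact ⟨⟨k, by simp⟩, by simp⟩

theorem exists_eq_graphSubmodule [FiniteDimensional F V] (he : ∀ v, v ∈ π ↔ (e v).2 = 0)
    {U : Submodule F V}
    (hU : Module.finrank F U = t) (hUπ : U ⊓ π = ⊥) : ∃ A, U = graphSubmodule e A := by
  let f : U →ₗ[F] (Fin t → F) := LinearMap.snd F _ _ ∘ₗ e.toLinearMap ∘ₗ U.subtype
  have hf : Function.Injective f := by
    rw [← LinearMap.ker_eq_bot, LinearMap.ker_eq_bot']
    intro v hv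
    have : (v : V) ∈ U ⊓ π := ⟨v.2, (he v).mpr hv⟩
    rw [hUπ] at this
    simpa using this
  let f' := LinearMap.linearEquivOfInjective f hf (by simp [hU])
  let M := LinearMap.toMatrix' (LinearMap.fst F _ _ ∘ₗ e.toLinearMap ∘ₗ U.subtype ∘ₗ
    f'.symm.toLinearMap)
  refine ⟨M, Submodule.eq_of_le_of_finrank_eq (fun v hv => ?_)
    (by rw [hU, finrank_graphSubmodule])⟩
  have h1 : (e v).2 = f' ⟨v, hv⟩ := rfl
  rw [mem_graphSubmodule, h1, LinearMap.toMatrix'_mulVec]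
  simp

/-- The projection of `L` to `F^t` has kernel `L ⊓ π` of dimension one, hence is onto by
rank-nullity. The first component of any linear section of it is a suitable `A`; another section
changes `A` by a matrix with column `(e w).1`. -/
theorem exists_eq_pencilSubmodule [FiniteDimensional F V] (he : ∀ v, v ∈ π ↔ (e v).2 = 0)
    {L : Submodule F V} {w : V}
    (hL : Module.finrank F L = t + 1) (hw : w ≠ 0) (hLπ : L ⊓ π = Submodule.span F {w}) :
    ∃ A, L = pencilSubmodule e A (e w).1 := by
  let f : L →ₗ[F] (Fin t → F) := LinearMap.snd F _ _ ∘ₗ e.toLinearMap ∘ₗ L.subtype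
  have hk : LinearMap.ker f = π.comap L.subtype := by
    ext v
    rw [LinearMap.mem_ker, Submodule.mem_comap, he]
    rfl
  have hf1 : Module.finrank F (LinearMap.ker f) = 1 := by
    rw [hk, ← Submodule.finrank_map_subtype_eq, Submodule.map_comap_subtype, hLπ,
      finrank_span_singleton hw]
  have hf : Function.Surjective f := by
    rw [← LinearMap.range_eq_top]
    apply Submodule.eq_top_of_finrank_eq
    have := f.finrank_range_add_finrank_ker
    simp only [Module.finrank_fin_fun]
    omega
  obtain ⟨s, hs⟩ := f.exists_rightInverse_of_surjective (LinearMap.range_eq_top.mpr hf)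
  have hs' (a) : (e (s a)).2 = a := LinearMap.congr_fun hs a
  have hwL : w ∈ L ⊓ π := hLπ ▸ Submodule.mem_span_singleton_self w
  have hw2 : (e w).2 = 0 := (he w).mp hwL.2
  have hw1 : (e w).1 ≠ 0 := fun h => hw (e.injective (by ext1 <;> simp [h, hw2]))
  refine ⟨LinearMap.toMatrix' (LinearMap.fst F _ _ ∘ₗ e.toLinearMap ∘ₗ L.subtype ∘ₗ s),
    (Submodule.eq_of_le_of_finrank_eq (fun v hv => ?_)
      (by rw [hL, finrank_pencilSubmodule _ hw1])).symm⟩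
  obtain ⟨k, hk⟩ := mem_pencilSubmodule.mp hv
  rw [LinearMap.toMatrix'_mulVec] at hk
  have : v = s (e v).2 + k • w := by
    apply e.injective
    ext1
    · simpa using hk
    · simp [hs', hw2]
  rw [this]
  exact add_mem (s _).2 (L.smul_mem _ hwL.1)

/-- Complements of `π` correspond to matrices. -/
noncomputable def graphEquiv [FiniteDimensional F V] (he : ∀ v, v ∈ π ↔ (e v).2 = 0) :
    Matrix (Fin m) (Fin t) F ≃
      {U : Submodule F V // Module.finrank F U = t ∧ U ⊓ π = ⊥} :=
  Equiv.ofBijective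
    (fun A => ⟨graphSubmodule e A, finrank_graphSubmodule A, graphSubmodule_inf he A⟩)
    ⟨fun _ _ h => graphSubmodule_injective (congrArg Subtype.val h), fun U => by
      obtain ⟨A, hA⟩ := exists_eq_graphSubmodule he U.2.1 U.2.2
      exact ⟨A, Subtype.ext hA.symm⟩⟩

end Coordinates

/-! ### The isomorphism between the matrix geometry and `X(n,t,q)`. -/

theorem matrixGeometry_lineExt (F : Type*) [Field F] (n t : ℕ) : (matrixGeometry F n t).LineExt :=
  fun _ _ h => Subtype.ext (Set.ext h)

theorem mem_vadd_matrixSubgroup {F : Type*} [Field F] {n t : ℕ} {b : Fin (n + 1) → F}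
    {A M : Matrix (Fin (n + 1)) (Fin t) F} :
    M ∈ A +ᵥ (matrixSubgroup t b : Set (Matrix (Fin (n + 1)) (Fin t) F)) ↔
      ∃ a, M = A + Matrix.vecMulVec b a := by
  rw [Set.mem_vadd_set]
  constructor
  · rintro ⟨_, ⟨a, rfl⟩, rfl⟩
    exact ⟨a, rfl⟩
  · rintro ⟨a, rfl⟩
    exact ⟨_, ⟨a, rfl⟩, rfl⟩

section Isomorphisms

variable {F V : Type*} [Field F] [AddCommGroup V] [Module F V] [FiniteDimensional F V] {n t : ℕ}
  {π : Submodule F V} {e : V ≃ₗ[F] (Fin (n + 1) → F) × (Fin t → F)}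

theorem exists_eq_pencilSubmodule_of_finrank (he : ∀ v, v ∈ π ↔ (e v).2 = 0) {L : Submodule F V}
    (hL : Module.finrank F L = t + 1)
    (hLπ : Module.finrank F (L ⊓ π : Submodule F V) = 1) :
    ∃ A b, b ≠ 0 ∧ L = pencilSubmodule e A b := by
  obtain ⟨w, hw, hspan⟩ := finrank_eq_one_iff'.mp hLπ
  have hw0 : (w : V) ≠ 0 := by simpa using hw
  have hspan' : L ⊓ π = Submodule.span F {(w : V)} := by
    apply le_antisymm
    · intro v hv
      obtain ⟨c, hc⟩ := hspan ⟨v, hv⟩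
      exact Submodule.mem_span_singleton.mpr ⟨c, congrArg Subtype.val hc⟩
    · rw [Submodule.span_singleton_le_iff_mem]
      exact w.2
  obtain ⟨A, hA⟩ := exists_eq_pencilSubmodule he hL hw0 hspan'
  refine ⟨A, _, fun h => hw0 (e.injective ?_), hA⟩
  have h2 : (e w).2 = 0 := (he w).mp w.2.2
  ext1 <;> simp [h, h2]

theorem geometryX_lineExt (ht : 0 < t) (he : ∀ v, v ∈ π ↔ (e v).2 = 0) :
    (geometryX t π).LineExt := by
  have key (L L' : (geometryX t π).Line)
      (h : ∀ p, (geometryX t π).Inc p L ↔ (geometryX t π).Inc p L') : L.1 ≤ L'.1 := by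
    obtain ⟨A, b, -, hA⟩ := exists_eq_pencilSubmodule_of_finrank he L.2.1 L.2.2
    rw [hA]
    refine pencilSubmodule_le ht fun M hM => (h (graphEquiv he M)).mp ?_
    exact hM.trans hA.ge
  exact fun L L' h => Subtype.ext (le_antisymm (key L L' h) (key L' L fun p => (h p).symm))

/-- The geometry of matrices is isomorphic to `X(n,t,q)`. -/
noncomputable def matrixIsoX (ht : 0 < t) (he : ∀ v, v ∈ π ↔ (e v).2 = 0) :
    (matrixGeometry F n t).Iso (geometryX t π) :=
  PointLineGeometry.Iso.ofPoints (G := matrixGeometry F n t) (G' := geometryX t π)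
    (graphEquiv he) (matrixGeometry_lineExt F n t) (geometryX_lineExt ht he)
    (by
      rintro ⟨C, b, hb, A, rfl⟩
      refine ⟨⟨pencilSubmodule e A b, finrank_pencilSubmodule A hb, ?_⟩, fun M => ?_⟩
      · rw [pencilSubmodule_inf he, finrank_span_singleton]
        simpa using hb
      · exact graphSubmodule_le_pencilSubmodule.trans mem_vadd_matrixSubgroup.symm)
    (by
      rintro ⟨L, hL1, hL2⟩
      obtain ⟨A, b, hb, rfl⟩ := exists_eq_pencilSubmodule_of_finrank he hL1 hL2
      exact ⟨⟨_, b, hb, A, rfl⟩, fun M =>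
        graphSubmodule_le_pencilSubmodule.trans mem_vadd_matrixSubgroup.symm⟩)

end Isomorphisms

/-! ### The isomorphism between the matrix geometry and `T*(S)`. -/

section LinearRepresentation

variable {F K W : Type*} [Field F] [Field K] [Algebra F K] [AddCommGroup W] [Module K W]
  [FiniteDimensional K W] {n t : ℕ} {H : Submodule K W} {S : Set (ℙ K W)}
  {e : W ≃ₗ[K] (Fin (n + 1) → K) × (Fin 1 → K)}

theorem submodule_not_le_iff_inf_eq_bot (P : ℙ K W) :
    ¬ P.submodule ≤ H ↔ P.submodule ⊓ H = ⊥ := by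
  induction P using Projectivization.ind with
  | h v hv =>
    rw [Projectivization.submodule_mk, Submodule.span_singleton_le_iff_mem, ← disjoint_iff,
      disjoint_comm, Submodule.disjoint_span_singleton' hv]

/-- Affine points correspond to complements of the hyperplane at infinity. -/
noncomputable def affinePointEquiv (H : Submodule K W) :
    {P : ℙ K W // ¬ P.submodule ≤ H} ≃
      {U : Submodule K W // Module.finrank K U = 1 ∧ U ⊓ H = ⊥} :=
  ((Projectivization.equivSubmodule K W).subtypeEquiv
    (q := fun U => U.1 ⊓ H = ⊥) submodule_not_le_iff_inf_eq_bot).trans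
    (Equiv.subtypeSubtypeEquivSubtypeInter (fun U : Submodule K W => Module.finrank K U = 1)
      (fun U => U ⊓ H = ⊥))

/-- A matrix over `F` as a column over `K`, along an isomorphism of `F^t` with `K`. -/
def columnEquiv (n : ℕ) (κ : (Fin t → F) ≃ₗ[F] K) :
    Matrix (Fin (n + 1)) (Fin t) F ≃ Matrix (Fin (n + 1)) (Fin 1) K where
  toFun M := Matrix.of fun i _ => κ (M i)
  invFun M := Matrix.of fun i => κ.symm (M i 0)
  left_inv M := by ext i j; simp
  right_inv M := by
    ext i j
    rw [Subsingleton.elim j 0]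
    exact κ.apply_symm_apply _

/-- Row `i` of `bᵀa` is `b i • a`, and `κ` is `F`-linear, so it goes to `b i` times `κ a`. The
cosets correspond because `κ a` runs through all of `K`. -/
theorem columnEquiv_eq_add_iff {κ : (Fin t → F) ≃ₗ[F] K}
    {M A : Matrix (Fin (n + 1)) (Fin t) F} {b : Fin (n + 1) → F} :
    (∃ a, columnEquiv n κ M = columnEquiv n κ A +
      Matrix.vecMulVec (fun i => algebraMap F K (b i)) a) ↔
      ∃ a, M = A + Matrix.vecMulVec b a := by
  have h (a : Fin t → F) : columnEquiv n κ (A + Matrix.vecMulVec b a) = columnEquiv n κ A +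
      Matrix.vecMulVec (fun i => algebraMap F K (b i)) (fun _ => κ a) := by
    ext i j
    have h1 : (A + Matrix.vecMulVec b a) i = A i + b i • a := by
      ext j; simp [Matrix.vecMulVec_apply]
    have h2 : columnEquiv n κ (A + Matrix.vecMulVec b a) i j =
      κ ((A + Matrix.vecMulVec b a) i) := rfl
    rw [h2, h1, map_add, map_smul, Algebra.smul_def]
    rfl
  constructor
  · rintro ⟨a, ha⟩
    refine ⟨κ.symm (a 0), (columnEquiv n κ).injective ?_⟩
    rw [h, ha, LinearEquiv.apply_symm_apply]
    congr
    ext j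
    rw [Subsingleton.elim j 0]
  · rintro ⟨a, rfl⟩
    exact ⟨_, h a⟩

theorem exists_eq_pencilSubmodule_of_mem (he : ∀ v, v ∈ H ↔ (e v).2 = 0)
    (hS : S = {P | ∃ a : Fin (n + 1) → F, a ≠ 0 ∧ P.submodule =
      Submodule.span K {e.symm (fun i => algebraMap F K (a i), 0)}})
    {L : Submodule K W} (hL : Module.finrank K L = 2) (hLS : ∃ P ∈ S, L ⊓ H = P.submodule) :
    ∃ A, ∃ b : Fin (n + 1) → F, b ≠ 0 ∧
      L = pencilSubmodule e A (fun i => algebraMap F K (b i)) := by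
  obtain ⟨P, hP, hLP⟩ := hLS
  rw [hS] at hP
  obtain ⟨b, hb, hPb⟩ := hP
  have hw : e.symm (fun i => algebraMap F K (b i), 0) ≠ 0 := by
    obtain ⟨i, hi⟩ := Function.ne_iff.mp hb
    intro h
    have h1 := congrFun (congrArg Prod.fst ((LinearEquiv.symm_apply_eq e).mp h)) i
    exact hi (by simpa using h1)
  obtain ⟨A, hA⟩ := exists_eq_pencilSubmodule he hL hw (hLP.trans hPb)
  exact ⟨A, b, hb, by simpa using hA⟩

theorem linearRepresentation_lineExt (he : ∀ v, v ∈ H ↔ (e v).2 = 0)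
    (hS : S = {P | ∃ a : Fin (n + 1) → F, a ≠ 0 ∧ P.submodule =
      Submodule.span K {e.symm (fun i => algebraMap F K (a i), 0)}}) :
    (linearRepresentation H S).LineExt := by
  have key (L L' : (linearRepresentation H S).Line)
      (h : ∀ p, (linearRepresentation H S).Inc p L ↔ (linearRepresentation H S).Inc p L') :
      L.1 ≤ L'.1 := by
    obtain ⟨A, b, -, hA⟩ := exists_eq_pencilSubmodule_of_mem he hS L.2.1 L.2.2
    rw [hA]
    refine pencilSubmodule_le one_pos fun M hM => ?_
    have hp : ((affinePointEquiv H).symm (graphEquiv he M)).1.submodule = graphSubmodule e M :=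
      congrArg Subtype.val ((affinePointEquiv H).apply_symm_apply (graphEquiv he M))
    have := (h ((affinePointEquiv H).symm (graphEquiv he M))).mp (hp.le.trans (hM.trans hA.ge))
    exact hp.ge.trans this
  exact fun L L' h => Subtype.ext (le_antisymm (key L L' h) (key L' L fun p => (h p).symm))

/-- The geometry of matrices is isomorphic to the linear representation of a subgeometry. -/
noncomputable def matrixIsoLinearRepresentation (κ : (Fin t → F) ≃ₗ[F] K)
    (he : ∀ v, v ∈ H ↔ (e v).2 = 0)
    (hS : S = {P | ∃ a : Fin (n + 1) → F, a ≠ 0 ∧ P.submodule =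
      Submodule.span K {e.symm (fun i => algebraMap F K (a i), 0)}}) :
    (matrixGeometry F n t).Iso (linearRepresentation H S) := by
  have hp (M) : ((affinePointEquiv H).symm (graphEquiv he (columnEquiv n κ M))).1.submodule =
      graphSubmodule e (columnEquiv n κ M) :=
    congrArg Subtype.val ((affinePointEquiv H).apply_symm_apply _)
  refine PointLineGeometry.Iso.ofPoints (G := matrixGeometry F n t)
    (G' := linearRepresentation H S)
    ((columnEquiv n κ).trans ((graphEquiv he).trans (affinePointEquiv H).symm))
    (matrixGeometry_lineExt F n t) (linearRepresentation_lineExt he hS) ?_ ?_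
  · rintro ⟨C, b, hb, A, rfl⟩
    have hb' : (fun i => algebraMap F K (b i)) ≠ 0 := by
      obtain ⟨i, hi⟩ := Function.ne_iff.mp hb
      exact fun h => hi (by simpa using congrFun h i)
    have hw : e.symm (fun i => algebraMap F K (b i), 0) ≠ 0 := by
      simpa using hb'
    refine ⟨⟨pencilSubmodule e (columnEquiv n κ A) (fun i => algebraMap F K (b i)),
      finrank_pencilSubmodule _ hb', Projectivization.mk K _ hw, ?_, ?_⟩, fun M => ?_⟩
    · rw [hS]
      exact ⟨b, hb, Projectivization.submodule_mk _ _⟩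
    · rw [pencilSubmodule_inf he, Projectivization.submodule_mk]
    · exact (iff_of_eq (congrArg (· ≤ _) (hp M))).trans
        (graphSubmodule_le_pencilSubmodule.trans
          (columnEquiv_eq_add_iff.trans mem_vadd_matrixSubgroup.symm))
  · rintro ⟨L, hL1, hL2⟩
    obtain ⟨A, b, hb, rfl⟩ := exists_eq_pencilSubmodule_of_mem he hS hL1 hL2
    obtain ⟨A, rfl⟩ := (columnEquiv n κ).surjective A
    exact ⟨⟨_, b, hb, A, rfl⟩, fun M => (iff_of_eq (congrArg (· ≤ _) (hp M))).trans
        (graphSubmodule_le_pencilSubmodule.trans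
          (columnEquiv_eq_add_iff.trans mem_vadd_matrixSubgroup.symm))⟩

end LinearRepresentation

/-! ### Rank one matrices. -/

section RankOne

variable {F : Type*} [Field F] {m t : ℕ}

theorem vecMulVec_zero_right (b : Fin m → F) :
    Matrix.vecMulVec b (0 : Fin t → F) = 0 := by
  ext; simp [Matrix.vecMulVec_apply]

/-- Proportional nonzero vectors give the same rank one matrices. -/
theorem exists_smul_of_vecMulVec_eq {b c : Fin m → F} {u w : Fin t → F}
    (h : Matrix.vecMulVec b u = Matrix.vecMulVec c w) (hu : u ≠ 0) : ∃ k : F, b = k • c := by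
  obtain ⟨j, hj⟩ := Function.ne_iff.mp hu
  refine ⟨w j / u j, ?_⟩
  ext i
  have := congrFun (congrFun h i) j
  simp only [Matrix.vecMulVec_apply] at this
  simp only [Pi.zero_apply] at hj
  simp only [Pi.smul_apply, smul_eq_mul]
  field_simp
  linear_combination this

/-- Compare the `j`-th columns, where `u j ≠ 0`. Geometrically, the directions of the three sides of
a triangle are linearly dependent. -/
theorem vecMulVec_eq_add {b c d : Fin m → F} {u w z : Fin t → F}
    (h : Matrix.vecMulVec b u = Matrix.vecMulVec c w + Matrix.vecMulVec d z) (hu : u ≠ 0) :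
    ∃ k l : F, b = k • c + l • d := by
  obtain ⟨j, hj⟩ := Function.ne_iff.mp hu
  refine ⟨w j / u j, z j / u j, ?_⟩
  ext i
  have := congrFun (congrFun h i) j
  simp only [Matrix.vecMulVec_apply, Matrix.add_apply] at this
  simp only [Pi.zero_apply] at hj
  simp only [Pi.smul_apply, smul_eq_mul, Pi.add_apply]
  field_simp
  linear_combination this

theorem vecMulVec_right_injective {b : Fin m → F} (hb : b ≠ 0) :
    Function.Injective (Matrix.vecMulVec b : (Fin t → F) → Matrix (Fin m) (Fin t) F) := by
  obtain ⟨i, hi⟩ := Function.ne_iff.mp hb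
  intro u w h
  ext j
  exact mul_left_cancel₀ hi (congrFun (congrFun h i) j)

/-- Rank one matrices with non-proportional columns are independent. -/
theorem eq_zero_of_vecMulVec_eq {b c : Fin m → F} {u w : Fin t → F}
    (hc : c ≠ 0) (hbc : ∀ k : F, b ≠ k • c)
    (h : Matrix.vecMulVec b u = Matrix.vecMulVec c w) : u = 0 ∧ w = 0 := by
  have hu : u = 0 := by
    by_contra hu
    obtain ⟨k, hk⟩ := exists_smul_of_vecMulVec_eq h hu
    exact hbc k hk
  refine ⟨hu, vecMulVec_right_injective hc ?_⟩
  rw [← h, hu]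
  ext; simp [Matrix.vecMulVec_apply]

/-- If `b ⊗ f(x) + c ⊗ g(x)` always has column `d`, then `g` is proportional to `f`. -/
theorem exists_smul_of_vecMulVec_add {X : Type*} {b c d : Fin m → F} {f g : X → Fin t → F}
    (hc : c ≠ 0) (hbc : ∀ k : F, b ≠ k • c)
    (h : ∀ x, ∃ k, Matrix.vecMulVec b (f x) + Matrix.vecMulVec c (g x) = Matrix.vecMulVec d k)
    {x₀ : X} (hx₀ : f x₀ ≠ 0) : ∃ κ : F, ∀ x, g x = κ • f x := by
  choose k hk using h
  have hk0 : k x₀ ≠ 0 := by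
    intro h0
    refine hx₀ (eq_zero_of_vecMulVec_eq hc hbc (w := - g x₀) ?_).1
    rw [Matrix.vecMulVec_neg, eq_neg_iff_add_eq_zero, hk, h0, vecMulVec_zero_right]
  -- With `d = α b + β c`, independence of `b` and `c` gives `f = α k` and `g = β k`, so the ratio
  -- `β / α` does not depend on `x`.
  obtain ⟨α, β, hd⟩ := vecMulVec_eq_add (hk x₀).symm hk0
  have key (x) : f x = α • k x ∧ g x = β • k x := by
    have h1 := hk x
    rw [hd, Matrix.add_vecMulVec, Matrix.smul_vecMulVec, Matrix.smul_vecMulVec,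
      ← Matrix.vecMulVec_smul, ← Matrix.vecMulVec_smul] at h1
    have h2 := eq_zero_of_vecMulVec_eq hc hbc (u := f x - α • k x) (w := β • k x - g x) (by
      rw [Matrix.vecMulVec_sub, Matrix.vecMulVec_sub]
      rw [sub_eq_sub_iff_add_eq_add, h1, add_comm])
    exact ⟨sub_eq_zero.mp h2.1, (sub_eq_zero.mp h2.2).symm⟩
  have hα : α ≠ 0 := by
    rintro rfl
    exact hx₀ (by rw [(key x₀).1, zero_smul])
  refine ⟨β / α, fun x => ?_⟩
  rw [(key x).1, (key x).2, smul_smul, div_mul_cancel₀ _ hα]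

theorem exists_ne_smul (hm : 2 ≤ m) {b : Fin m → F} (hb : b ≠ 0) :
    ∃ c : Fin m → F, ∀ k : F, c ≠ k • b := by
  obtain ⟨i, hi⟩ := Function.ne_iff.mp hb
  have : Nontrivial (Fin m) := Fin.nontrivial_iff_two_le.mpr hm
  obtain ⟨j, hj⟩ := exists_ne i
  refine ⟨Pi.single j 1, fun k h => ?_⟩
  have h1 := congrFun h i
  have h2 := congrFun h j
  simp only [Pi.single_apply, hj.symm, if_false, Pi.smul_apply, smul_eq_mul] at h1
  have hk : k = 0 := by
    rcases mul_eq_zero.mp h1.symm with h | h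
    · exact h
    · exact absurd h hi
  simp [hk] at h2

/-- Every matrix is a sum of rank one matrices whose columns avoid a given direction. -/
theorem rankOne_induction (hm : 2 ≤ m) {b : Fin m → F} (hb : b ≠ 0)
    {P : Matrix (Fin m) (Fin t) F → Prop} (h0 : P 0) (hadd : ∀ x y, P x → P y → P (x + y))
    (h : ∀ c a, (∀ k : F, c ≠ k • b) → P (Matrix.vecMulVec c a)) (x : Matrix (Fin m) (Fin t) F) :
    P x := by
  have h' (c a) : P (Matrix.vecMulVec c a) := by
    by_cases hc : ∀ k : F, c ≠ k • b
    · exact h c a hc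
    · push Not at hc
      obtain ⟨k, rfl⟩ := hc
      obtain ⟨c, hc⟩ := exists_ne_smul hm hb
      -- A column along `b` is split into two columns off `⟨b⟩`; this needs a vector `c` off `⟨b⟩`,
      -- hence `2 ≤ m`.
      have : k • b = (k • b - c) + c := by abel
      rw [this, Matrix.add_vecMulVec]
      refine hadd _ _ (h _ _ fun l hl => hc (k - l) ?_) (h _ _ hc)
      rw [sub_smul, ← hl]; abel
  induction x using Matrix.induction_on' with
  | h_zero => exact h0
  | h_add x y hx hy => exact hadd x y hx hy
  | h_std_basis i j a =>
    rw [← mul_one a, ← smul_eq_mul, ← Matrix.smul_single,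
      Matrix.single_eq_single_vecMulVec_single, ← Matrix.vecMulVec_smul]
    exact h' _ _

end RankOne

/-! ### Line-preserving permutations of matrices are semilinear up to translation. -/

section Classification

variable {F : Type*} [Field F] {n t : ℕ}

theorem matrixSubgroup_le_smul (b : Fin (n + 1) → F) (k : F) :
    matrixSubgroup t (k • b) ≤ matrixSubgroup t b := by
  rintro _ ⟨a, rfl⟩
  exact ⟨k • a, by dsimp only; rw [Matrix.vecMulVec_smul, Matrix.smul_vecMulVec]⟩

theorem matrixSubgroup_smul (b : Fin (n + 1) → F) {k : F} (hk : k ≠ 0) :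
    matrixSubgroup t (k • b) = matrixSubgroup t b := by
  refine le_antisymm (matrixSubgroup_le_smul b k) ?_
  conv_lhs => rw [← inv_smul_smul₀ hk b]
  exact matrixSubgroup_le_smul _ _

theorem matrixSubgroup_eq_of_smul {b c : Fin (n + 1) → F} (hb : b ≠ 0) {k : F}
    (h : b = k • c) : matrixSubgroup t b = matrixSubgroup t c := by
  rw [h]
  refine matrixSubgroup_smul c ?_
  rintro rfl
  exact hb (by rw [h, zero_smul])

/-- A permutation of matrices maps lines to lines of the geometry of matrices. -/
def PreservesLines (φ : Equiv.Perm (Matrix (Fin (n + 1)) (Fin t) F)) : Prop :=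
  ∀ x b, b ≠ 0 → ∃ b', b' ≠ 0 ∧
    ∀ y, φ y - φ x ∈ matrixSubgroup t b' ↔ y - x ∈ matrixSubgroup t b

/-- The image of `x + L_b` is a coset of some `L_b'` containing the image of `x`, which can
therefore serve as its base point. -/
theorem preservesLines_of_aut (g : (matrixGeometry F n t).Aut) : PreservesLines g.1.1 := by
  intro x b hb
  obtain ⟨b', hb', A, hA⟩ := (g.1.2 ⟨_, b, hb, x, rfl⟩).2
  let φ : Equiv.Perm (Matrix (Fin (n + 1)) (Fin t) F) := g.1.1
  have h' (y : Matrix (Fin (n + 1)) (Fin t) F) :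
      φ y ∈ A +ᵥ (matrixSubgroup t b' : Set (Matrix (Fin (n + 1)) (Fin t) F)) ↔
      y ∈ x +ᵥ (matrixSubgroup t b : Set (Matrix (Fin (n + 1)) (Fin t) F)) := by
    rw [← hA]
    exact g.2 y ⟨_, b, hb, x, rfl⟩
  have hsub (B : Matrix (Fin (n + 1)) (Fin t) F) (c) (y) :
      y ∈ B +ᵥ (matrixSubgroup t c : Set (Matrix (Fin (n + 1)) (Fin t) F)) ↔ y - B ∈ matrixSubgroup t c := by
    rw [Set.mem_vadd_set_iff_neg_vadd_mem, vadd_eq_add, neg_add_eq_sub]; rfl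
  have hx := (h' x).mpr ((hsub _ _ _).mpr (by rw [sub_self]; exact zero_mem _))
  rw [hsub] at hx
  refine ⟨b', hb', fun y => ?_⟩
  rw [← hsub x, ← h', hsub, ← sub_add_sub_cancel (φ y) (φ x) A]
  exact ((matrixSubgroup t b').add_mem_cancel_right hx).symm

theorem exists_third [Finite F] (h3 : 3 ≤ Nat.card F ^ t) (a : Fin t → F) :
    ∃ a' : Fin t → F, a' ≠ 0 ∧ a' ≠ a := by
  have : Fintype F := Fintype.ofFinite F
  classical
  have hc : ({0, a} : Finset (Fin t → F)).card < Fintype.card (Fin t → F) := by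
    refine Finset.card_le_two.trans_lt ?_
    rw [Nat.card_eq_fintype_card] at h3
    simp
    omega
  obtain ⟨x, hx⟩ := Finset.exists_mem_notMem_of_card_lt_card (t := Finset.univ) hc
  exact ⟨x, by simpa using hx⟩

/-- Line-preserving permutations preserve parallelism of lines in a common plane. -/
theorem parallel_step [Finite F] (h3 : 3 ≤ Nat.card F ^ t)
    {φ : Equiv.Perm (Matrix (Fin (n + 1)) (Fin t) F)} (hφ : PreservesLines φ)
    {b c β β' : Fin (n + 1) → F} {a : Fin t → F} {x : Matrix (Fin (n + 1)) (Fin t) F}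
    (ha : a ≠ 0) (hb : b ≠ 0) (hcb : ∀ k : F, c ≠ k • b) (hβ0 : β ≠ 0) (hβ0' : β' ≠ 0)
    (hβ : ∀ y, φ y - φ x ∈ matrixSubgroup t β ↔ y - x ∈ matrixSubgroup t b)
    (hβ' : ∀ y, φ y - φ (x + Matrix.vecMulVec c a) ∈ matrixSubgroup t β' ↔
      y - (x + Matrix.vecMulVec c a) ∈ matrixSubgroup t b) :
    matrixSubgroup t β' = matrixSubgroup t β := by
  have hc : c ≠ 0 := by
    rintro rfl
    exact hcb 0 (by simp)
  have hbc : b + c ≠ 0 := fun h => hcb (-1) (by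
    rw [neg_one_smul]; exact (neg_eq_of_add_eq_zero_right h).symm)
  -- The point `p` is a third point on the line joining `x` and `y`. The line through `p` with
  -- direction `b + c` meets the two parallel lines of direction `b` in `r` and `s`; this is where
  -- `q^t ≥ 3` is needed.
  obtain ⟨a', ha0, haa⟩ := exists_third h3 a
  set y := x + Matrix.vecMulVec c a with hy
  set p := x + Matrix.vecMulVec c a' with hp
  set r := x - Matrix.vecMulVec b a' with hr
  set s := y - Matrix.vecMulVec b (a' - a) with hs
  obtain ⟨γ, hγ0, hγ⟩ := hφ x c hc
  obtain ⟨δ, hδ0, hδ⟩ := hφ p (b + c) hbc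
  obtain ⟨u, hu⟩ := (hβ r).mpr ⟨-a', by dsimp only; rw [hr, Matrix.vecMulVec_neg]; abel⟩
  obtain ⟨u', hu'⟩ := (hβ' s).mpr ⟨-(a' - a), by dsimp only; rw [hs, Matrix.vecMulVec_neg]; abel⟩
  obtain ⟨w, hw⟩ := (hγ y).mpr ⟨a, by rw [hy]; abel⟩
  obtain ⟨w', hw'⟩ := (hγ p).mpr ⟨a', by rw [hp]; abel⟩
  obtain ⟨z, hz⟩ := (hδ r).mpr ⟨-a', by
    dsimp only
    rw [hr, hp, Matrix.vecMulVec_neg, Matrix.add_vecMulVec]; abel⟩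
  obtain ⟨z', hz'⟩ := (hδ s).mpr ⟨-(a' - a), by
    dsimp only
    rw [hs, hp, hy, Matrix.vecMulVec_neg, Matrix.add_vecMulVec, Matrix.vecMulVec_sub,
      Matrix.vecMulVec_sub]; abel⟩
  dsimp only at hu hu' hw hw' hz hz'
  have hu0 : u ≠ 0 := by
    rintro rfl
    rw [vecMulVec_zero_right, eq_comm, sub_eq_zero, φ.injective.eq_iff, hr, sub_eq_self] at hu
    exact ha0 (vecMulVec_right_injective hb (hu.trans (vecMulVec_zero_right b).symm))
  have hu0' : u' ≠ 0 := by
    rintro rfl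
    rw [vecMulVec_zero_right, eq_comm, sub_eq_zero, φ.injective.eq_iff, hs, sub_eq_self] at hu'
    exact haa (sub_eq_zero.mp
      (vecMulVec_right_injective hb (hu'.trans (vecMulVec_zero_right b).symm)))
  -- The images of the triangles `x, p, r` and `y, p, s` put both `β` and `β'` in the span of `γ`
  -- and `δ`.
  obtain ⟨k, l, hkl⟩ := vecMulVec_eq_add (b := β) (c := γ) (d := δ) (w := w') (z := z)
    (by rw [hu, hw', hz]; abel) hu0
  obtain ⟨k', l', hkl'⟩ := vecMulVec_eq_add (b := β') (c := γ) (d := δ) (w := w' - w) (z := z')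
    (by rw [hu', Matrix.vecMulVec_sub, hw, hw', hz']; abel) hu0'
  by_cases hdet : k * l' - k' * l = 0
  · have h1 : l • β' = l' • β := by
      rw [hkl, hkl']
      ext i
      simp only [Pi.smul_apply, Pi.add_apply, smul_eq_mul]
      linear_combination (-γ i) * hdet
    have h2 : k • β' = k' • β := by
      rw [hkl, hkl']
      ext i
      simp only [Pi.smul_apply, Pi.add_apply, smul_eq_mul]
      linear_combination (δ i) * hdet
    by_cases hl : l = 0
    · have hk : k ≠ 0 := by
        rintro rfl
        exact hβ0 (by rw [hkl, hl]; simp)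
      exact matrixSubgroup_eq_of_smul hβ0' (k := k⁻¹ * k')
        (by rw [mul_smul, ← h2, inv_smul_smul₀ hk])
    · exact matrixSubgroup_eq_of_smul hβ0' (k := l⁻¹ * l')
        (by rw [mul_smul, ← h1, inv_smul_smul₀ hl])
  · exfalso
    -- If the determinant is nonzero, `γ` is a combination of `β` and `β'` by Cramer's rule. The
    -- image lines then meet in `φ o`, so the original parallel lines meet in `o` and would
    -- coincide, against the choice of `c`.
    set D := k * l' - k' * l
    have hγD : γ = (l' / D) • β - (l / D) • β' := by
      rw [hkl, hkl']
      ext i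
      simp only [Pi.smul_apply, Pi.add_apply, Pi.sub_apply, smul_eq_mul]
      field_simp
      ring
    obtain ⟨o, ho⟩ := φ.surjective (φ x + Matrix.vecMulVec β ((l' / D) • w))
    have h1 : o - x ∈ matrixSubgroup t b := (hβ o).mp ⟨(l' / D) • w, by rw [ho]; abel⟩
    have h2 : o - y ∈ matrixSubgroup t b := (hβ' o).mp ⟨(l / D) • w, by
      have h4 : φ y = φ x + Matrix.vecMulVec γ w := by rw [hw]; abel
      rw [ho, h4, hγD]
      ext i j
      simp [Matrix.vecMulVec_apply]
      ring⟩
    have h4 : Matrix.vecMulVec c a ∈ matrixSubgroup t b := by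
      have : Matrix.vecMulVec c a = (o - x) - (o - y) := by rw [hy]; abel
      rw [this]
      exact sub_mem h1 h2
    obtain ⟨a'', h5⟩ := h4
    obtain ⟨κ, hκ⟩ := exists_smul_of_vecMulVec_eq h5.symm ha
    exact hcb κ hκ

/-- Line-preserving permutations preserve parallelism. -/
theorem PreservesLines.exists_direction [Finite F] (h3 : 3 ≤ Nat.card F ^ t) (hn : 1 ≤ n)
    {φ : Equiv.Perm (Matrix (Fin (n + 1)) (Fin t) F)} (hφ : PreservesLines φ)
    {b : Fin (n + 1) → F} (hb : b ≠ 0) : ∃ b', b' ≠ 0 ∧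
      ∀ x y, φ y - φ x ∈ matrixSubgroup t b' ↔ y - x ∈ matrixSubgroup t b := by
  choose d hd0 hd using fun x => hφ x b hb
  refine ⟨d 0, hd0 0, fun x y => ?_⟩
  -- `parallel_step` covers rank one translations with column off `⟨b⟩`, and these generate all
  -- translations.
  have key (z) : ∀ x, matrixSubgroup t (d (x + z)) = matrixSubgroup t (d x) := by
    refine rankOne_induction (by omega : 2 ≤ n + 1) hb (P := fun z => ∀ x,
      matrixSubgroup t (d (x + z)) = matrixSubgroup t (d x)) (fun x => by rw [add_zero])
      (fun z z' h h' x => by rw [← add_assoc, h', h]) (fun c a hc x => ?_) z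
    rcases eq_or_ne a 0 with rfl | ha
    · rw [vecMulVec_zero_right, add_zero]
    exact parallel_step h3 hφ ha hb hc (hd0 _) (hd0 _) (hd x) (hd _)
  rw [← key x 0, zero_add]
  exact hd x y

/-- Permutations that map parallel lines to parallel lines are additive up to a translation. -/
theorem map_add_of_direction (hn : 1 ≤ n)
    {φ : Equiv.Perm (Matrix (Fin (n + 1)) (Fin t) F)}
    {d : (Fin (n + 1) → F) → (Fin (n + 1) → F)} (hd0 : ∀ b, b ≠ 0 → d b ≠ 0)
    (hd : ∀ b, b ≠ 0 → ∀ x y, φ y - φ x ∈ matrixSubgroup t (d b) ↔ y - x ∈ matrixSubgroup t b)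
    (hdd : ∀ b c, b ≠ 0 → (∀ k : F, c ≠ k • b) → ∀ k : F, d c ≠ k • d b)
    (x y) : φ (x + y) - φ 0 = (φ x - φ 0) + (φ y - φ 0) := by
  have step (b) (hb : b ≠ 0) (a : Fin t → F) (z) : ∀ x,
      φ (x + z + Matrix.vecMulVec b a) - φ (x + z) = φ (x + Matrix.vecMulVec b a) - φ x := by
    refine rankOne_induction (by omega : 2 ≤ n + 1) hb (P := fun z => ∀ x,
      φ (x + z + Matrix.vecMulVec b a) - φ (x + z) = φ (x + Matrix.vecMulVec b a) - φ x)
      (fun x => by rw [add_zero]) (fun z z' h h' x => ?_) (fun c a' hc x => ?_) z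
    · rw [← add_assoc, h', h]
    · have hc0 : c ≠ 0 := by
        rintro rfl
        exact hc 0 (by simp)
      -- The defect of the image of a parallelogram lies in both `L_(d b)` and `L_(d c)`, which
      -- intersect trivially.
      have h1 : φ (x + Matrix.vecMulVec c a' + Matrix.vecMulVec b a) -
          φ (x + Matrix.vecMulVec c a') - (φ (x + Matrix.vecMulVec b a) - φ x) ∈
          matrixSubgroup t (d b) :=
        sub_mem ((hd b hb _ _).mpr ⟨a, by abel⟩) ((hd b hb _ _).mpr ⟨a, by abel⟩)
      have h2 : φ (x + Matrix.vecMulVec c a' + Matrix.vecMulVec b a) -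
          φ (x + Matrix.vecMulVec b a) - (φ (x + Matrix.vecMulVec c a') - φ x) ∈
          matrixSubgroup t (d c) :=
        sub_mem ((hd c hc0 _ _).mpr ⟨a', by abel⟩) ((hd c hc0 _ _).mpr ⟨a', by abel⟩)
      obtain ⟨u, hu⟩ := h1
      obtain ⟨w, hw⟩ := h2
      dsimp only at hu hw
      have h5 : Matrix.vecMulVec (d c) w = Matrix.vecMulVec (d b) u := by
        rw [hu, hw]; abel
      have := (eq_zero_of_vecMulVec_eq (hd0 b hb) (hdd b c hb hc) h5).2
      rw [this, vecMulVec_zero_right] at hu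
      exact (sub_eq_zero.mp hu.symm)
  -- The avoided direction is arbitrary here; it only serves the induction principle.
  have hb : (Pi.single 0 1 : Fin (n + 1) → F) ≠ 0 := by simp
  refine rankOne_induction (by omega : 2 ≤ n + 1) hb (P := fun y => ∀ x,
    φ (x + y) - φ 0 = (φ x - φ 0) + (φ y - φ 0)) (fun x => by simp) (fun y y' h h' x => ?_)
    (fun c a hc x => ?_) y x
  · rw [← add_assoc, h' (x + y), h x, h' y]; abel
  · have hc0 : c ≠ 0 := by
      rintro rfl
      exact hc 0 (by simp)
    have := step c hc0 a x 0
    rw [zero_add, zero_add] at this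
    rw [← sub_eq_iff_eq_add', ← this]; abel

theorem sum_single_vecMulVec (M : Matrix (Fin (n + 1)) (Fin t) F) :
    ∑ i, Matrix.vecMulVec (Pi.single i 1) (M i) = M := by
  ext k l
  simp [Matrix.sum_apply, Matrix.vecMulVec_apply, Pi.single_apply]

theorem ne_smul_symm {b c : Fin (n + 1) → F} (hb : b ≠ 0) (h : ∀ k : F, c ≠ k • b) (k : F) :
    b ≠ k • c := by
  intro hk
  have hk0 : k ≠ 0 := by
    rintro rfl
    exact hb (by rw [hk, zero_smul])
  exact h k⁻¹ (by rw [hk, inv_smul_smul₀ hk0])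

theorem single_ne_smul_single {i j : Fin (n + 1)} (hij : i ≠ j) (k : F) :
    (Pi.single i 1 : Fin (n + 1) → F) ≠ k • Pi.single j 1 := by
  intro h
  have := congrFun h i
  simp [hij] at this

/-- The automorphisms of the geometry of matrices have the form `M ↦ G M^σ H + N`. -/
theorem PreservesLines.exists_semilinear [Finite F] (h3 : 3 ≤ Nat.card F ^ t) (hn : 1 ≤ n)
    (ht : 0 < t) {φ : Equiv.Perm (Matrix (Fin (n + 1)) (Fin t) F)} (hφ : PreservesLines φ) :
    ∃ (σ : F ≃+* F) (G : Matrix (Fin (n + 1)) (Fin (n + 1)) F) (H : Matrix (Fin t) (Fin t) F)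
      (N : Matrix (Fin (n + 1)) (Fin t) F), IsUnit G ∧ IsUnit H ∧
        ∀ M, φ M = G * M.map σ * H + N := by
  have hdir (b : Fin (n + 1) → F) (hb : b ≠ 0) := hφ.exists_direction h3 hn hb
  choose! d hd0 hd using hdir
  set a₀ : Fin t → F := fun _ => 1
  have ha₀ : a₀ ≠ 0 := fun h => one_ne_zero (congrFun h ⟨0, ht⟩)
  -- Otherwise the lines through `0` with directions `b` and `c` would have the same image.
  have hdd (b c) (hb : b ≠ 0) (hbc : ∀ k : F, c ≠ k • b) (k : F) : d c ≠ k • d b := by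
    intro hk
    have hc0 : c ≠ 0 := by
      rintro rfl
      exact hbc 0 (by simp)
    have h1 : Matrix.vecMulVec c a₀ - 0 ∈ matrixSubgroup t c := ⟨a₀, by simp⟩
    rw [← hd c hc0, matrixSubgroup_eq_of_smul (hd0 c hc0) hk, hd b hb, sub_zero] at h1
    obtain ⟨a, ha⟩ := h1
    obtain ⟨l, hl⟩ := exists_smul_of_vecMulVec_eq ha.symm ha₀
    exact hbc l hl
  let ψ : Matrix (Fin (n + 1)) (Fin t) F →+ Matrix (Fin (n + 1)) (Fin t) F :=
    AddMonoidHom.mk' (fun x => φ x - φ 0) (map_add_of_direction hn hd0 hd hdd)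
  have hψ : Function.Injective ψ := fun x y h => φ.injective (sub_left_injective h)
  have hL (b : Fin (n + 1) → F) (hb : b ≠ 0) (a : Fin t → F) :
      ∃ u, Matrix.vecMulVec (d b) u = ψ (Matrix.vecMulVec b a) :=
    (hd b hb 0 _).mpr ⟨a, by simp⟩
  choose! h hh using hL
  have hne (b) (hb : b ≠ 0) (a) (ha : a ≠ 0) : h b a ≠ 0 := by
    intro h0
    have h1 := hh b hb a
    rw [h0, vecMulVec_zero_right, eq_comm, map_eq_zero_iff ψ hψ] at h1
    exact ha (vecMulVec_right_injective hb (h1.trans (vecMulVec_zero_right b).symm))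
  -- Expand the image of `(b + l c)ᵀ a` by additivity: the sum of the terms with columns `d b` and
  -- `d c` must again have the single column `d (b + l c)`, so the two rows are proportional by a
  -- factor independent of `a`.
  have hprop (b c) (hb : b ≠ 0) (hbc : ∀ k : F, c ≠ k • b) (l : F) :
      ∃ κ : F, ∀ a, h c (l • a) = κ • h b a := by
    have hc0 : c ≠ 0 := by
      rintro rfl
      exact hbc 0 (by simp)
    have hs : b + l • c ≠ 0 := fun h0 =>
      ne_smul_symm hb hbc (-l) (by rw [neg_smul]; exact eq_neg_of_add_eq_zero_left h0)
    refine exists_smul_of_vecMulVec_add (b := d b) (c := d c) (d := d (b + l • c)) (hd0 c hc0)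
      (hdd c b hc0 (ne_smul_symm hb hbc)) (fun a => ⟨h (b + l • c) a, ?_⟩) (hne b hb a₀ ha₀)
    rw [hh b hb, hh c hc0, hh _ hs, ← map_add, Matrix.add_vecMulVec, Matrix.smul_vecMulVec,
      Matrix.vecMulVec_smul]
  have he (i : Fin (n + 1)) : (Pi.single i 1 : Fin (n + 1) → F) ≠ 0 := by simp
  set η : (Fin t → F) → (Fin t → F) := h (Pi.single 0 1) with hη
  have hη₀ : η a₀ ≠ 0 := hne _ (he 0) a₀ ha₀
  have hcoef (i : Fin (n + 1)) : ∃ κ : F, κ ≠ 0 ∧ ∀ a, h (Pi.single i 1) a = κ • η a := by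
    rcases eq_or_ne i 0 with rfl | hi
    · exact ⟨1, one_ne_zero, fun a => by rw [one_smul]⟩
    · obtain ⟨κ, hκ⟩ := hprop _ _ (he 0) (single_ne_smul_single hi) 1
      refine ⟨κ, ?_, fun a => by rw [← hκ, one_smul]⟩
      rintro rfl
      exact hne _ (he i) a₀ ha₀ (by simpa using hκ a₀)
  choose κ hκ0 hκ using hcoef
  have hψe (i a) : ψ (Matrix.vecMulVec (Pi.single i 1) a) =
      Matrix.vecMulVec (κ i • d (Pi.single i 1)) (η a) := by
    rw [← hh _ (he i), hκ, Matrix.smul_vecMulVec, Matrix.vecMulVec_smul]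
  have hκd (i) : κ i • d (Pi.single i 1) ≠ 0 := smul_ne_zero (hκ0 i) (hd0 _ (he i))
  have hηadd (a a') : η (a + a') = η a + η a' := by
    apply vecMulVec_right_injective (hκd 0)
    rw [← hψe, Matrix.vecMulVec_add, Matrix.vecMulVec_add, map_add, hψe, hψe]
  -- Compare the row map of a second basis vector at `l • a` in two ways: `hprop` relates it to `η
  -- a`, and `hκ` to `η (l • a)`. The second basis vector exists because `1 ≤ n`.
  have hσ (l : F) : ∃ s : F, ∀ a, η (l • a) = s • η a := by
    have h10 : (⟨1, by omega⟩ : Fin (n + 1)) ≠ 0 := by simp [Fin.ext_iff]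
    obtain ⟨s, hs⟩ := hprop _ _ (he 0) (single_ne_smul_single h10) l
    refine ⟨(κ ⟨1, by omega⟩)⁻¹ * s, fun a => ?_⟩
    rw [mul_smul, ← hs, hκ, inv_smul_smul₀ (hκ0 _)]
  choose σ₀ hσ₀ using hσ
  have hinj := smul_left_injective F hη₀
  let η' : (Fin t → F) →+ (Fin t → F) := AddMonoidHom.mk' η hηadd
  let σ₁ : F →+* F :=
    { toFun := σ₀
      map_one' := hinj (by simp only [← hσ₀, one_smul])
      map_mul' := fun x y => hinj (by simp only [mul_smul, ← hσ₀])
      map_zero' := hinj (by simp only [← hσ₀, zero_smul]; exact map_zero η')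
      map_add' := fun x y => hinj (by simp only [add_smul, ← hσ₀, hηadd]) }
  let σ : F ≃+* F := RingEquiv.ofBijective σ₁ (Finite.injective_iff_bijective.mp σ₁.injective)
  -- The columns of `G` are the image directions of the basis vectors, rescaled by `κ i` so that all
  -- share the row map `η`; the rows of `H` are the values of `η` on the standard basis.
  let G : Matrix (Fin (n + 1)) (Fin (n + 1)) F :=
    Matrix.of fun k i => (κ i • d (Pi.single i 1)) k
  let H : Matrix (Fin t) (Fin t) F := Matrix.of fun j => η (Pi.single j 1)
  have hηH (a : Fin t → F) (l) : η a l = ∑ j, σ (a j) * H j l := by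
    conv_lhs => rw [pi_eq_sum_univ' a]
    have h1 : η (∑ j, a j • Pi.single j 1) = ∑ j, η (a j • Pi.single j 1) :=
      map_sum η' _ _
    rw [h1, Finset.sum_apply]
    refine Finset.sum_congr rfl fun j _ => ?_
    rw [hσ₀]
    rfl
  have hform (M) : ψ M = G * M.map σ * H := by
    conv_lhs => rw [← sum_single_vecMulVec M]
    rw [map_sum, Matrix.mul_assoc]
    ext k l
    rw [Matrix.sum_apply, Matrix.mul_apply]
    refine Finset.sum_congr rfl fun i _ => ?_
    rw [hψe, Matrix.vecMulVec_apply, hηH, Matrix.mul_apply]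
    rfl
  have hzero (M : Matrix (Fin (n + 1)) (Fin t) F) (h0 : G * M * H = 0) : M = 0 := by
    have h1 : ψ (M.map σ.symm) = 0 := by
      have h2 : (M.map σ.symm).map σ = M := by ext; simp
      rw [hform, h2, h0]
    rw [map_eq_zero_iff ψ hψ] at h1
    ext i j
    simpa using congrFun (congrFun h1 i) j
  refine ⟨σ, G, H, φ 0, ?_, ?_, fun M => by rw [← hform]; exact (sub_add_cancel _ _).symm⟩
  · rw [← Matrix.mulVec_injective_iff_isUnit]
    refine (injective_iff_map_eq_zero G.mulVecLin).mpr fun v hv => ?_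
    by_contra hv0
    have := hzero (Matrix.vecMulVec v a₀) (by
      rw [Matrix.mul_vecMulVec, show G.mulVec v = 0 from hv]; simp)
    exact hv0 (by
      ext i
      simpa [Matrix.vecMulVec_apply, a₀] using congrFun (congrFun this i) ⟨0, ht⟩)
  · rw [← Matrix.vecMul_injective_iff_isUnit]
    refine (injective_iff_map_eq_zero H.vecMulLinear).mpr fun v hv => ?_
    have := hzero (Matrix.vecMulVec (Pi.single 0 1) v) (by
      rw [Matrix.mul_assoc, Matrix.vecMulVec_mul, show Matrix.vecMul v H = 0 from hv,
        vecMulVec_zero_right, Matrix.mul_zero])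
    exact vecMulVec_right_injective (he 0) (this.trans (vecMulVec_zero_right _).symm)

end Classification

/-! ### The action of `PΓL` on subspaces and on `X(n,t,q)`. -/

section SubspaceAction

variable {F V : Type*} [Field F] [AddCommGroup V] [Module F V]

/-- The subspace spanned by the image of a subspace under a permutation of the points. -/
def imageSubspace (g : Equiv.Perm (ℙ F V)) (U : Submodule F V) : Submodule F V :=
  ⨆ P : {P : ℙ F V // P.submodule ≤ U}, (g P.1).submodule

/-- `imageSubspace` depends only on the permutation of points, so the action involves no choice of
semilinear map; this identity lets any inducing `f` be used for computations. -/
theorem imageSubspace_eq_map {σ τ : F →+* F} [RingHomInvPair σ τ] [RingHomInvPair τ σ]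
    {g : Equiv.Perm (ℙ F V)} {f : V ≃ₛₗ[σ] V}
    (hf : ∀ P, g P = Projectivization.map f.toLinearMap f.injective P) (U : Submodule F V) :
    imageSubspace g U = U.map f.toLinearMap := by
  apply le_antisymm
  · refine iSup_le ?_
    rintro ⟨P, hP⟩
    induction P using Projectivization.ind with
    | h v hv =>
      rw [Projectivization.submodule_mk, Submodule.span_singleton_le_iff_mem] at hP
      simp only [hf, Projectivization.map_mk, Projectivization.submodule_mk]
      rw [Submodule.span_singleton_le_iff_mem]
      exact Submodule.mem_map_of_mem hP
  · rintro _ ⟨v, hv, rfl⟩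
    rcases eq_or_ne v 0 with rfl | hv0
    · simp
    have hP : (Projectivization.mk F v hv0).submodule ≤ U := by
      rwa [Projectivization.submodule_mk, Submodule.span_singleton_le_iff_mem]
    refine (le_iSup (fun P : {P : ℙ F V // P.submodule ≤ U} => (g P.1).submodule) ⟨_, hP⟩) ?_
    simp only [hf, Projectivization.map_mk, Projectivization.submodule_mk]
    exact Submodule.mem_span_singleton_self _

theorem imageSubspace_mul (g g' : PGammaL F V) (U : Submodule F V) :
    imageSubspace (g * g').1 U = imageSubspace g.1 (imageSubspace g'.1 U) := by
  obtain ⟨_, _, _, _, f, hf⟩ := g.2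
  obtain ⟨_, _, _, _, f', hf'⟩ := g'.2
  obtain ⟨_, _, _, _, k, hk⟩ := (g * g').2
  rw [imageSubspace_eq_map hf, imageSubspace_eq_map hf']
  apply le_antisymm
  · refine iSup_le ?_
    rintro ⟨P, hP⟩
    induction P using Projectivization.ind with
    | h v hv =>
      rw [Projectivization.submodule_mk, Submodule.span_singleton_le_iff_mem] at hP
      simp only [Subgroup.coe_mul, Equiv.Perm.mul_apply, hf, hf', Projectivization.map_mk,
        Projectivization.submodule_mk]
      rw [Submodule.span_singleton_le_iff_mem]
      exact Submodule.mem_map_of_mem (Submodule.mem_map_of_mem hP)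
  · rintro _ ⟨_, ⟨v, hv, rfl⟩, rfl⟩
    rcases eq_or_ne v 0 with rfl | hv0
    · simp
    have hP : (Projectivization.mk F v hv0).submodule ≤ U := by
      rwa [Projectivization.submodule_mk, Submodule.span_singleton_le_iff_mem]
    refine (le_iSup (fun P : {P : ℙ F V // P.submodule ≤ U} =>
      ((g * g').1 P.1).submodule) ⟨_, hP⟩) ?_
    simp only [Subgroup.coe_mul, Equiv.Perm.mul_apply, hf, hf', Projectivization.map_mk,
      Projectivization.submodule_mk]
    exact Submodule.mem_span_singleton_self _

theorem imageSubspace_one (U : Submodule F V) : imageSubspace (1 : Equiv.Perm (ℙ F V)) U = U := by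
  rw [imageSubspace_eq_map (σ := RingHom.id F) (τ := RingHom.id F) (f := LinearEquiv.refl F V)]
  · exact Submodule.map_id U
  · intro P
    induction P using Projectivization.ind with
    | h v hv => rfl

/-- The action of `PΓL` on the subspaces. -/
def subspaceAction (F V : Type*) [Field F] [AddCommGroup V] [Module F V] :
    PGammaL F V →* Equiv.Perm (Submodule F V) where
  toFun g :=
    { toFun := imageSubspace g.1
      invFun := imageSubspace (g⁻¹).1
      left_inv := fun U => by
        rw [← imageSubspace_mul, inv_mul_cancel]; exact imageSubspace_one U
      right_inv := fun U => by
        rw [← imageSubspace_mul, mul_inv_cancel]; exact imageSubspace_one U }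
  map_one' := Equiv.ext imageSubspace_one
  map_mul' g g' := Equiv.ext (imageSubspace_mul g g')

theorem exists_subspaceAction_eq_map (g : PGammaL F V) :
    ∃ (σ τ : F →+* F) (_ : RingHomInvPair σ τ) (_ : RingHomInvPair τ σ) (f : V ≃ₛₗ[σ] V),
      (∀ P, g.1 P = Projectivization.map f.toLinearMap f.injective P) ∧
        ∀ U, subspaceAction F V g U = U.map f.toLinearMap := by
  obtain ⟨σ, τ, h1, h2, f, hf⟩ := g.2
  exact ⟨σ, τ, h1, h2, f, hf, imageSubspace_eq_map hf⟩

theorem finrank_map_semilinearEquiv {σ τ : F →+* F} [RingHomInvPair σ τ] [RingHomInvPair τ σ]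
    (f : V ≃ₛₗ[σ] V) (U : Submodule F V) :
    Module.finrank F (U.map f.toLinearMap) = Module.finrank F U := by
  have h := rank_eq_of_equiv_equiv σ (f.submoduleMap U).toAddEquiv
    (RingHomInvPair.toRingEquiv σ τ).bijective (fun r m => (f.submoduleMap U).map_smulₛₗ r m)
  exact (congrArg Cardinal.toNat h).symm

theorem finrank_subspaceAction (g : PGammaL F V) (U : Submodule F V) :
    Module.finrank F (subspaceAction F V g U : Submodule F V) = Module.finrank F U := by
  obtain ⟨σ, τ, _, _, f, -, hf⟩ := exists_subspaceAction_eq_map g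
  rw [hf, finrank_map_semilinearEquiv]

theorem subspaceAction_le_iff (g : PGammaL F V) {U U' : Submodule F V} :
    subspaceAction F V g U ≤ subspaceAction F V g U' ↔ U ≤ U' := by
  obtain ⟨σ, τ, _, _, f, -, hf⟩ := exists_subspaceAction_eq_map g
  rw [hf, hf]
  exact Submodule.map_le_map_iff_of_injective f.injective _ _

theorem subspaceAction_inf (g : PGammaL F V) (U U' : Submodule F V) :
    subspaceAction F V g (U ⊓ U') = subspaceAction F V g U ⊓ subspaceAction F V g U' := by
  obtain ⟨σ, τ, _, _, f, -, hf⟩ := exists_subspaceAction_eq_map g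
  rw [hf, hf, hf]
  exact Submodule.map_inf _ f.injective

theorem submodule_le_iff_subspaceAction (g : PGammaL F V) (P : ℙ F V) (U : Submodule F V) :
    (g.1 P).submodule ≤ subspaceAction F V g U ↔ P.submodule ≤ U := by
  obtain ⟨σ, τ, _, _, f, hf, hf'⟩ := exists_subspaceAction_eq_map g
  rw [hf, hf']
  induction P using Projectivization.ind with
  | h v hv =>
    rw [Projectivization.map_mk, Projectivization.submodule_mk, Projectivization.submodule_mk,
      Submodule.span_singleton_le_iff_mem, Submodule.span_singleton_le_iff_mem]
    exact Function.Injective.mem_set_image f.injective (s := (U : Set V))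

theorem le_of_points {U U' : Submodule F V}
    (h : ∀ P : ℙ F V, P.submodule ≤ U → P.submodule ≤ U') : U ≤ U' := by
  intro v hv
  rcases eq_or_ne v 0 with rfl | hv0
  · exact zero_mem _
  have := h (Projectivization.mk F v hv0)
  rw [Projectivization.submodule_mk, Submodule.span_singleton_le_iff_mem,
    Submodule.span_singleton_le_iff_mem] at this
  exact this hv

theorem mem_PGammaLStabilizer_iff {π : Submodule F V} {g : PGammaL F V} :
    g ∈ PGammaLStabilizer π ↔ subspaceAction F V g π = π := by
  have h1 (P : ℙ F V) : g • P = g.1 P := rfl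
  rw [PGammaLStabilizer, MulAction.mem_stabilizer_iff]
  constructor
  · intro h
    have h2 (P : ℙ F V) : (g.1 P).submodule ≤ π ↔ P.submodule ≤ π := by
      have := Set.smul_mem_smul_set_iff (a := g) (s := {P : ℙ F V | P.submodule ≤ π}) (x := P)
      rw [h] at this
      exact this
    apply le_antisymm <;> refine le_of_points fun P hP => ?_ <;>
      obtain ⟨P, rfl⟩ := g.1.surjective P
    · rwa [h2, ← submodule_le_iff_subspaceAction g]
    · rwa [submodule_le_iff_subspaceAction, ← h2]
  · intro h
    ext P
    obtain ⟨P, rfl⟩ := g.1.surjective P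
    rw [← h1, Set.smul_mem_smul_set_iff, Set.mem_ofPred_eq, Set.mem_ofPred_eq, h1]
    conv_rhs => rw [← h]
    exact (submodule_le_iff_subspaceAction g P π).symm

theorem subspaceAction_inf_of_mem {π : Submodule F V} {g : PGammaL F V}
    (hg : g ∈ PGammaLStabilizer π) (U : Submodule F V) :
    subspaceAction F V g U ⊓ π = subspaceAction F V g (U ⊓ π) := by
  rw [subspaceAction_inf, mem_PGammaLStabilizer_iff.mp hg]

theorem subspaceAction_eq_bot_iff (g : PGammaL F V) {U : Submodule F V} :
    subspaceAction F V g U = ⊥ ↔ U = ⊥ := by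
  obtain ⟨σ, τ, _, _, f, -, hf⟩ := exists_subspaceAction_eq_map g
  rw [hf]
  exact Submodule.map_eq_bot_iff

/-- The stabiliser of `π` acts on the geometry `X(n,t,q)`. -/
def stabilizerToAut (t : ℕ) (π : Submodule F V) :
    PGammaLStabilizer π →* (geometryX t π).Aut where
  toFun g :=
    ⟨((subspaceAction F V g.1).subtypePerm fun U => by
        rw [finrank_subspaceAction, subspaceAction_inf_of_mem g.2, subspaceAction_eq_bot_iff],
      (subspaceAction F V g.1).subtypePerm fun L => by
        rw [finrank_subspaceAction, subspaceAction_inf_of_mem g.2, finrank_subspaceAction]),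
      fun _ _ => subspaceAction_le_iff g.1⟩
  map_one' := by
    apply Subtype.ext
    apply Prod.ext <;> ext x : 1 <;>
      exact Subtype.ext (Equiv.congr_fun (map_one (subspaceAction F V)) x.1)
  map_mul' g g' := by
    apply Subtype.ext
    apply Prod.ext <;> ext x : 1 <;>
      exact Subtype.ext (Equiv.congr_fun (map_mul (subspaceAction F V) g.1 g'.1) x.1)

end SubspaceAction

/-! ### The stabiliser of `π` is the automorphism group of `X(n,t,q)`. -/

section Main

variable {F V : Type*} [Field F] [AddCommGroup V] [Module F V] {n t : ℕ}
  {π : Submodule F V} {e : V ≃ₗ[F] (Fin (n + 1) → F) × (Fin t → F)}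

/-- A collineation that fixes all complements of `π` fixes all points off `π`. -/
theorem exists_smul_of_fixes_graphs {σ τ : F →+* F} [RingHomInvPair σ τ] [RingHomInvPair τ σ]
    {f : V ≃ₛₗ[σ] V}
    (hf : ∀ A, (graphSubmodule e A).map f.toLinearMap = graphSubmodule e A) {v : V}
    (hv : (e v).2 ≠ 0) : ∃ k : F, f v = k • v := by
  obtain ⟨j, hj⟩ := Function.ne_iff.mp hv
  rw [Pi.zero_apply] at hj
  set a := (e v).2 with ha
  set c := (e (f v)).2 with hc
  -- The graph of `A` contains `v`, and so does that of `A + B` whenever `B` kills `a`; hence `f v`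
  -- lies on all of them.
  set A := Matrix.vecMulVec (e v).1 (Pi.single j (a j)⁻¹) with hA
  have hAa : A.mulVec a = (e v).1 := by
    rw [hA, Matrix.vecMulVec_mulVec, single_dotProduct, inv_mul_cancel₀ hj]
    simp
  have key (B : Matrix (Fin (n + 1)) (Fin t) F) (hB : B.mulVec a = 0) :
      (e (f v)).1 = (A + B).mulVec c := by
    rw [hc, ← mem_graphSubmodule, ← hf]
    refine Submodule.mem_map_of_mem (mem_graphSubmodule.mpr ?_)
    rw [← ha, Matrix.add_mulVec, hAa, hB, add_zero]
  have h0 := key 0 (Matrix.zero_mulVec a)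
  rw [add_zero] at h0
  have hca : c = (c j / a j) • a := by
    ext i
    -- This `B` has the row `a j e_i - a i e_j`, orthogonal to `a`; that it kills `c` too is the
    -- vanishing of a `2 × 2` minor.
    have h1 := key (Matrix.vecMulVec (Pi.single 0 1) (Pi.single i (a j) - Pi.single j (a i))) (by
      rw [Matrix.vecMulVec_mulVec, sub_dotProduct, single_dotProduct, single_dotProduct,
        mul_comm, sub_self]
      simp)
    rw [Matrix.add_mulVec, ← h0, left_eq_add, Matrix.vecMulVec_mulVec] at h1
    have h2 := congrFun h1 0
    simp only [sub_dotProduct, single_dotProduct] at h2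
    have h3 : a j * c i - a i * c j = 0 := by simpa using h2
    rw [Pi.smul_apply, smul_eq_mul]
    field_simp
    linear_combination h3
  refine ⟨c j / a j, e.injective ?_⟩
  rw [map_smul]
  ext1
  · rw [h0, hca, Matrix.mulVec_smul, hAa]
    simp [hj]
  · exact hca

theorem stabilizerToAut_injective (ht : 0 < t) [FiniteDimensional F V]
    (he : ∀ v, v ∈ π ↔ (e v).2 = 0) : Function.Injective (stabilizerToAut t π) := by
  rw [injective_iff_map_eq_one]
  intro g hg
  obtain ⟨σ, τ, _, _, f, hfP, hf⟩ := exists_subspaceAction_eq_map g.1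
  have hgraph (A) : (graphSubmodule e A).map f.toLinearMap = graphSubmodule e A := by
    rw [← hf]
    exact congrArg Subtype.val
      (Equiv.congr_fun (congrArg (fun x => x.1.1) hg) (graphEquiv he A))
  have hπ : π.map f.toLinearMap = π := by rw [← hf, mem_PGammaLStabilizer_iff.mp g.2]
  have hsmul (v : V) : ∃ k : F, f v = k • v := by
    by_cases hv : (e v).2 = 0
    -- For `v` in `π`, both `u` and `u + v` are off `π` and are scaled by `f`, say by `k` and `l`.
    -- Then `(k - l) u` lies in `π`, so `k = l` and `f v = l v`.
    · set u := e.symm (0, Pi.single ⟨0, ht⟩ 1) with hu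
      obtain ⟨k, hk⟩ := exists_smul_of_fixes_graphs hgraph (v := u) (by simp [hu])
      obtain ⟨l, hl⟩ := exists_smul_of_fixes_graphs hgraph (v := u + v) (by simp [hu, hv])
      have hfv : f v ∈ π := by
        rw [← hπ]
        exact Submodule.mem_map_of_mem ((he v).mpr hv)
      rw [map_add, hk, smul_add] at hl
      have hkl : (k - l) • u = l • v - f v := by
        rw [sub_smul, sub_eq_sub_iff_add_eq_add, hl, add_comm]
      have h2 : (k - l) • u ∈ π := by
        rw [hkl]
        exact sub_mem (π.smul_mem l ((he v).mpr hv)) hfv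
      rw [he, map_smul] at h2
      have h3 : k - l = 0 := by simpa [hu] using h2
      rw [h3, zero_smul, eq_comm, sub_eq_zero] at hkl
      exact ⟨l, hkl.symm⟩
    · exact exists_smul_of_fixes_graphs hgraph hv
  apply Subtype.ext
  apply Subtype.ext
  ext P : 1
  rw [hfP]
  induction P using Projectivization.ind with
  | h v hv =>
    obtain ⟨k, hk⟩ := hsmul v
    rw [Projectivization.map_mk]
    refine (Projectivization.mk_eq_mk_iff' F _ _ _ _).mpr ⟨k, hk.symm⟩

/-- Every map `M ↦ G M^σ H + N` of matrices is induced by a semilinear map stabilising `π`. -/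
theorem exists_semilinearEquiv [Finite F] [FiniteDimensional F V]
    (he : ∀ v, v ∈ π ↔ (e v).2 = 0) (σ : F ≃+* F)
    {G : Matrix (Fin (n + 1)) (Fin (n + 1)) F} {H : Matrix (Fin t) (Fin t) F}
    (hG : IsUnit G) (hH : IsUnit H) (N : Matrix (Fin (n + 1)) (Fin t) F) :
    ∃ (ρ τ : F →+* F) (_ : RingHomInvPair ρ τ) (_ : RingHomInvPair τ ρ) (f : V ≃ₛₗ[ρ] V),
      (∀ A, (graphSubmodule e A).map f.toLinearMap = graphSubmodule e (G * A.map σ * H + N)) ∧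
        π.map f.toLinearMap = π := by
  have i1 := RingHomInvPair.of_ringEquiv σ
  have i2 := RingHomInvPair.of_ringEquiv_symm σ
  have : Finite V := Module.finite_of_finite F
  have hadd {k : ℕ} (x y : Fin k → F) : σ ∘ (x + y) = σ ∘ x + σ ∘ y := by ext; simp
  have hsmul {k : ℕ} (r : F) (x : Fin k → F) : σ ∘ (r • x) = σ r • (σ ∘ x) := by ext; simp
  have hzero {k : ℕ} {x : Fin k → F} (h : σ ∘ x = 0) : x = 0 := by
    ext i
    simpa using congrFun h i
  have hmap {k l : ℕ} (A : Matrix (Fin k) (Fin l) F) (x : Fin l → F) :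
      σ ∘ A.mulVec x = (A.map σ).mulVec (σ ∘ x) := by
    ext i
    exact RingHom.map_mulVec (σ : F →+* F) A x i
  have hH' : H * H⁻¹ = 1 := Matrix.mul_nonsing_inv H ((Matrix.isUnit_iff_isUnit_det H).mp hH)
  -- With `c = H⁻¹ a^σ`, a vector `(Aa, a)` goes to `(G A^σ a^σ + N c, c)`. Since `a^σ = H c`, this
  -- lies on the graph of `G A^σ H + N`.
  let f₀ : V →ₛₗ[(σ : F →+* F)] V :=
    { toFun := fun v => e.symm (G.mulVec (σ ∘ (e v).1) + N.mulVec (H⁻¹.mulVec (σ ∘ (e v).2)),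
        H⁻¹.mulVec (σ ∘ (e v).2))
      map_add' := fun v w => by
        rw [← map_add]
        congr 1
        ext1
        · simp only [map_add, Prod.fst_add, Prod.snd_add, hadd, Matrix.mulVec_add]
          abel
        · simp only [map_add, Prod.snd_add, hadd, Matrix.mulVec_add]
      map_smul' := fun r v => by
        rw [← map_smul]
        congr 1
        ext1
        · simp only [map_smul, Prod.smul_fst, Prod.smul_snd, hsmul, Matrix.mulVec_smul, smul_add]
          rfl
        · simp only [map_smul, Prod.smul_snd, hsmul, Matrix.mulVec_smul]
          rfl }
  have hf₁ (v) : (e (f₀ v)).1 =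
      G.mulVec (σ ∘ (e v).1) + N.mulVec (H⁻¹.mulVec (σ ∘ (e v).2)) := by
    simp [f₀]
  have hf₂ (v) : (e (f₀ v)).2 = H⁻¹.mulVec (σ ∘ (e v).2) := by simp [f₀]
  have hinj : Function.Injective f₀ := by
    rw [injective_iff_map_eq_zero]
    intro v hv
    have h1 := hf₁ v
    have h2 := hf₂ v
    rw [← h2, hv, map_zero, Prod.fst_zero, Prod.snd_zero, Matrix.mulVec_zero, add_zero] at h1
    rw [hv, map_zero, Prod.snd_zero] at h2
    have h3 := congrArg H.mulVec h2
    rw [Matrix.mulVec_mulVec, hH', Matrix.one_mulVec, Matrix.mulVec_zero] at h3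
    have h4 := Matrix.mulVec_injective_iff_isUnit.mpr hG
      (h1.symm.trans (Matrix.mulVec_zero G).symm)
    apply e.injective
    rw [map_zero]
    ext1
    · exact hzero h4
    · exact hzero h3.symm
  let f : V ≃ₛₗ[(σ : F →+* F)] V :=
    LinearEquiv.ofBijective f₀ (Finite.injective_iff_bijective.mp hinj)
  refine ⟨_, _, i1, i2, f, fun A => ?_, ?_⟩
  · refine Submodule.eq_of_le_of_finrank_eq ?_
      (by rw [finrank_map_semilinearEquiv, finrank_graphSubmodule, finrank_graphSubmodule])
    rintro _ ⟨v, hv, rfl⟩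
    have hv' := mem_graphSubmodule.mp hv
    rw [mem_graphSubmodule]
    change (e (f₀ v)).1 = Matrix.mulVec _ (e (f₀ v)).2
    rw [hf₁, hf₂, hv', hmap, Matrix.add_mulVec, Matrix.mulVec_mulVec, Matrix.mulVec_mulVec,
      Matrix.mulVec_mulVec, Matrix.mul_assoc (G * A.map σ), hH', Matrix.mul_one]
  · refine Submodule.eq_of_le_of_finrank_eq ?_ (finrank_map_semilinearEquiv f π)
    rintro _ ⟨v, hv, rfl⟩
    have hv' := (he v).mp hv
    rw [he]
    change (e (f₀ v)).2 = 0
    have h0 : σ ∘ (0 : Fin t → F) = 0 := by ext; simp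
    rw [hf₂, hv', h0, Matrix.mulVec_zero]

theorem stabilizerToAut_surjective [Finite F] [FiniteDimensional F V]
    (h3 : 3 ≤ Nat.card F ^ t) (hn : 1 ≤ n) (ht : 0 < t)
    (he : ∀ v, v ∈ π ↔ (e v).2 = 0) : Function.Surjective (stabilizerToAut t π) := by
  intro α
  let I := matrixIsoX ht he
  obtain ⟨σ, G, H, N, hG, hH, hφ⟩ :=
    (preservesLines_of_aut (I.symm.autCongr α)).exists_semilinear h3 hn ht
  have hα (A) : α.1.1 (graphEquiv he A) = graphEquiv he (G * A.map σ * H + N) := by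
    rw [← hφ]
    exact (I.onPoints.apply_symm_apply (α.1.1 (I.onPoints A))).symm
  obtain ⟨σ', τ', h1, h2, f, hf, hfπ⟩ := exists_semilinearEquiv he σ hG hH N
  let g : Equiv.Perm (ℙ F V) := Equiv.ofBijective
    (Projectivization.map f.toLinearMap f.injective)
    ⟨Projectivization.map_injective _ _, fun P => by
      induction P using Projectivization.ind with
      | h v hv =>
        exact ⟨Projectivization.mk F (f.symm v) (by simpa using hv), by
          simp [Projectivization.map_mk]⟩⟩
  let g' : PGammaL F V := ⟨g, σ', τ', h1, h2, f, fun P => rfl⟩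
  have hg (U) : subspaceAction F V g' U = U.map f.toLinearMap :=
    imageSubspace_eq_map (fun P => rfl) U
  refine ⟨⟨g', mem_PGammaLStabilizer_iff.mpr (by rw [hg, hfπ])⟩,
    PointLineGeometry.Aut.ext_points (geometryX_lineExt ht he) fun p => ?_⟩
  obtain ⟨A, rfl⟩ := (graphEquiv he).surjective p
  rw [hα]
  exact Subtype.ext ((hg _).trans (hf A))

end Main

theorem mainTheorem1 (n t q : ℕ) {F K V W : Type*}
    [Field F] [Finite F] [Field K] [Finite K] [Algebra F K]
    (hF : Nat.card F = q) (hK : Nat.card K = q ^ t)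
    [AddCommGroup V] [Module F V] (hV : Module.finrank F V = n + t + 1)
    (π : Submodule F V) (hπ : Module.finrank F π = n + 1)
    [AddCommGroup W] [Module K W] (hW : Module.finrank K W = n + 2)
    (H : Submodule K W) (hH : Module.finrank K H = n + 1)
    (S : Set (ℙ K W)) (hS : IsSubgeometry F n H S) :
    Nonempty ((geometryX t π).Iso (matrixGeometry F n t)) ∧
    Nonempty ((matrixGeometry F n t).Iso (linearRepresentation H S)) ∧
    Nonempty ((geometryX t π).Iso (linearRepresentation H S)) ∧
    Nonempty ((linearRepresentation H S).Aut ≃* (geometryX t π).Aut) ∧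
    (1 ≤ n → (2 ≤ t ∨ 2 < q) →
      Nonempty ((geometryX t π).Aut ≃* PGammaLStabilizer π)) := by
  have : FiniteDimensional F V := Module.finite_of_finrank_pos (by omega)
  have : FiniteDimensional K W := Module.finite_of_finrank_pos (by omega)
  have hq : 1 < q := hF ▸ Finite.one_lt_card
  -- Positivity of `t` comes from `K` having more than one element.
  have ht : 0 < t := by
    rcases Nat.eq_zero_or_pos t with rfl | h
    · have : 1 < Nat.card K := Finite.one_lt_card
      rw [hK, pow_zero] at this
      exact absurd this (lt_irrefl 1)
    · exact h
  have hFK : Module.finrank F K = t := by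
    have := Module.natCard_eq_pow_finrank (K := F) (V := K)
    rw [hK, hF] at this
    exact (Nat.pow_right_injective hq this).symm
  obtain ⟨e, he, -⟩ := exists_coordinates (m := n + 1) (t := t) (by omega) π
    (LinearEquiv.ofFinrankEq _ _ (by simp [hπ]))
  obtain ⟨b, hb⟩ := hS
  obtain ⟨e', he', heb⟩ := exists_coordinates (m := n + 1) (t := 1) (by omega) H b.equivFun
  -- The coordinates `e'` extend those of the basis defining the subgeometry, so `S` becomes the set
  -- of points at infinity with coordinates in `F`.
  have hS' : S = {P | ∃ a : Fin (n + 1) → F, a ≠ 0 ∧ P.submodule =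
      Submodule.span K {e'.symm (fun i => algebraMap F K (a i), 0)}} := by
    have hsum (a : Fin (n + 1) → F) : ∑ i, algebraMap F K (a i) • (b i : W) =
        e'.symm (fun i => algebraMap F K (a i), 0) := by
      have h1 : ∑ i, algebraMap F K (a i) • (b i : W) =
          (b.equivFun.symm (fun i => algebraMap F K (a i)) : H) := by
        simp [Module.Basis.equivFun_symm_apply]
      rw [LinearEquiv.eq_symm_apply, h1, heb, LinearEquiv.apply_symm_apply]
    simpa only [hsum] using hb
  have κ : (Fin t → F) ≃ₗ[F] K := LinearEquiv.ofFinrankEq _ _ (by simp [hFK])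
  let I := matrixIsoX (n := n) ht he
  let J := matrixIsoLinearRepresentation κ he' hS'
  refine ⟨⟨I.symm⟩, ⟨J⟩, ⟨I.symm.trans J⟩, ⟨(J.symm.trans I).autCongr⟩, fun hn htq => ?_⟩
  have h3 : 3 ≤ Nat.card F ^ t := by
    rw [hF]
    rcases htq with h | h
    · calc 3 ≤ 2 ^ 2 := by norm_num
        _ ≤ q ^ 2 := Nat.pow_le_pow_left hq 2
        _ ≤ q ^ t := Nat.pow_le_pow_right (by omega) h
    · exact h.trans_le (Nat.le_self_pow ht.ne' q)
  exact ⟨(MulEquiv.ofBijective (stabilizerToAut t π)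
    ⟨stabilizerToAut_injective ht he, stabilizerToAut_surjective h3 hn ht he⟩).symm⟩
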